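/- Let $G$ be a finite group. A Tambara functor $T$ on $G$ assigns to each finite $G$-set $X$ a commutative ring $T(X)$ and to each $G$-map $f\colon X\to Y$ a restriction $f^*\colon T(Y)\to T(X)$ (a ring homomorphism), an additive transfer $f_+\colon T(X)\to T(Y)$ (a homomorphism of additive groups) and a multiplicative transfer $f_\bullet\colon T(X)\to T(Y)$ (a homomorphism of multiplicative monoids), all functorial, such that $T(X\amalg Y)\to T(X)\times T(Y)$ is bijective, the Mackey condition holds for $f_+$ and for $f_\bullet$ on pullback squares, and $f_\bullet p_+=q_+\rho_\bullet\lambda^*$ holds for every exponential diagram $X\xleftarrow{p}A\xleftarrow{\lambda}Z\xrightarrow{\rho}B\xrightarrow{q}Y$ over $f\colon X\to Y$ (that is, $B=\Pi_f(A)$ is the dependent product, $Z=X\times_Y B$, and $\lambda$ is evaluation). An isomorphism of Tambara functors is a family of ring isomorphisms that commutes with $f^*$, $f_+$ and $f_\bullet$ for all $f$. Write $\mathrm{pt}_X\colon X\to G/G$ for the constant map. Let $\Omega$ be the Burnside Tambara functor: $\Omega(X)$ is the Grothendieck ring of the category of finite $G$-sets over $X$ (under disjoint union and fibre product), and for $f\colon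 X\to Y$ the maps $f^*$, $f_+$, $f_\bullet$ are induced by pullback along $f$, composition with $f$, and the dependent product $\Pi_f$. Let $\mathcal P_{\mathbb Q}$ be the fixed point functor of $\mathbb Q$ with trivial $G$-action: $\mathcal P_{\mathbb Q}(X)$ is the ring of $G$-maps $X\to\mathbb Q$, with $f^*(\varphi)=\varphi\circ f$, $f_+(\varphi)(y)=\sum_{x\in f^{-1}(y)}\varphi(x)$ and $f_\bullet(\varphi)(y)=\prod_{x\in f^{-1}(y)}\varphi(x)$. Let $\mathcal Z\subseteq\Omega(G/e)$ be the set of elements that are not zero divisors, and put $S_0=\{r\in\Omega(G/G) : \mathrm{pt}_{G/e}^*(r)\in\mathcal Z\}$. For a transitive finite $G$-set $X$ let $$\mathcal U_{\mathcal Z}(X)=\{x\in\Omega(X) : ax\in \mathrm{pt}_X^*(S_0)\ \text{for some } a\in\Omega(X)\},$$ and for a general finite $G$-set $X$ let $\mathcal U_{\mathcal Z}(X)$ consist of the elements of $\Omega(X)$ whose restriction to each orbit $X_i$ of $X$ lies in $\mathcal U_{\mathcal Z}(X_i)$. This is a family of multiplicative submonoids of the $\Omega(X)$ closed under all $f^*$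 and $f_\bullet$. Let $\mathcal U_{\mathcal Z}^{-1}\Omega$ be the Tambara functor $X\mapsto\mathcal U_{\mathcal Z}(X)^{-1}\Omega(X)$ (localization of rings) with structure maps, for $f\colon X\to Y$, $$f^*\Big(\frac yt\Big)=\frac{f^*(y)}{f^*(t)},\qquad f_\bullet\Big(\frac xs\Big)=\frac{f_\bullet(x)}{f_\bullet(s)},\qquad f_+\Big(\frac xs\Big)=\frac{f_+(ax)}{f_\bullet(s)},$$ where $a\in\Omega(X)$ is any element with $f^*(f_\bullet(s))=as$. Then there is an isomorphism of Tambara functors $\mathcal U_{\mathcal Z}^{-1}\Omega\cong\mathcal P_{\mathbb Q}$. -/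

import Mathlib

universe u v w

/-! ### Finite `G`-sets -/

/-- A finite `G`-set. -/
structure FinGSet (G : Type u) [Group G] where
  carrier : Type u
  [action : MulAction G carrier]
  [finite : Finite carrier]

namespace FinGSet

variable {G : Type u} [Group G]

instance : CoeSort (FinGSet G) (Type u) := ⟨FinGSet.carrier⟩

attribute [instance] FinGSet.action FinGSet.finite

/-- The transitive free `G`-set `G/e`: the group `G` with left translation. -/
abbrev free (G : Type u) [Group G] [Finite G] : FinGSet G := ⟨G⟩

/-- The one-point `G`-set `G/G`. -/
abbrev point (G : Type u) [Group G] : FinGSet G := ⟨PUnit⟩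

/-- The constant map `pt_X : X → G/G`. -/
def toPoint (X : FinGSet G) : X →[G] point G := ⟨fun _ => PUnit.unit, fun _ _ => rfl⟩

/-- The disjoint union of finite `G`-sets. -/
def sum (X Y : FinGSet G) : FinGSet G := ⟨X ⊕ Y⟩

/-- The inclusion `X → X ⨿ Y`. -/
def inl (X Y : FinGSet G) : X →[G] sum X Y := ⟨Sum.inl, fun _ _ => rfl⟩

/-- The inclusion `Y → X ⨿ Y`. -/
def inr (X Y : FinGSet G) : Y →[G] sum X Y := ⟨Sum.inr, fun _ _ => rfl⟩

/-- The product of finite `G`-sets. -/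
def prod (X Y : FinGSet G) : FinGSet G := ⟨X × Y⟩

/-- A `G`-invariant subset of a finite `G`-set. -/
def sub (X : FinGSet G) (P : X → Prop) (h : ∀ (g : G) x, P x → P (g • x)) : FinGSet G :=
  letI : MulAction G {x : X // P x} :=
    { smul := fun g x => ⟨g • x.1, h g _ x.2⟩
      one_smul := fun x => Subtype.ext (one_smul G x.1)
      mul_smul := fun a b x => Subtype.ext (mul_smul a b x.1) }
  ⟨{x : X // P x}⟩

/-- The inclusion of an invariant subset. -/
def subVal (X : FinGSet G) (P : X → Prop) (h : ∀ (g : G) x, P x → P (g • x)) :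
    sub X P h →[G] X := ⟨fun x => x.1, fun _ _ => rfl⟩

/-- The fibre product of `f : X → Z` and `g : Y → Z`. -/
def pb {X Y Z : FinGSet G} (f : X →[G] Z) (g : Y →[G] Z) : FinGSet G :=
  sub (prod X Y) (fun p => f p.1 = g p.2) (fun a p h =>
    (map_smul f a p.1).trans ((congrArg (a • ·) h).trans (map_smul g a p.2).symm))

/-- First projection of a fibre product. -/
def pbFst {X Y Z : FinGSet G} (f : X →[G] Z) (g : Y →[G] Z) : pb f g →[G] X :=
  ⟨fun p => p.1.1, fun _ _ => rfl⟩

/-- Second projection of a fibre product. -/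
def pbSnd {X Y Z : FinGSet G} (f : X →[G] Z) (g : Y →[G] Z) : pb f g →[G] Y :=
  ⟨fun p => p.1.2, fun _ _ => rfl⟩

/-- A `G`-set is transitive if it consists of exactly one orbit. -/
def IsTransitive (X : FinGSet G) : Prop :=
  Nonempty X ∧ ∀ x y : X, ∃ g : G, g • x = y

/-- The commutative square with `f ∘ ξ = η ∘ f'` is a pullback square. -/
def IsPullback {X' X Y' Y : FinGSet G} (ξ : X' →[G] X) (f' : X' →[G] Y')
    (f : X →[G] Y) (η : Y' →[G] Y) : Prop :=
  (∀ x', f (ξ x') = η (f' x')) ∧ ∀ x y', f x = η y' → ∃! x', ξ x' = x ∧ f' x' = y'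

/-- `X ←p A ←lam Z →rho B →q Y` is an exponential diagram over `f : X → Y`, that is, isomorphic to
the canonical one: the square on `Z` is a pullback, `Z = X ×_Y B`, and the points of `B` over `y`
correspond, through `lam`, to the sections `σ` of `p` over the fibre `f⁻¹(y)`, so that `B` is the
dependent product `Π_f(A)` and `lam` is the evaluation. -/
def IsExponential {X Y A Z B : FinGSet G} (f : X →[G] Y) (p : A →[G] X) (lam : Z →[G] A)
    (rho : Z →[G] B) (q : B →[G] Y) : Prop :=
  IsPullback (p.comp lam) rho f q ∧
    ∀ (y : Y) (σ : {x : X // f x = y} → A), (∀ x, p (σ x) = x.1) →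
      ∃! b : B, q b = y ∧
        ∀ (z : Z) (x : {x : X // f x = y}), rho z = b → p (lam z) = x.1 → lam z = σ x

end FinGSet

open FinGSet

/-! ### Tambara functors -/

/-- A Tambara functor on the group `G`: restrictions `res f = f^*`, additive transfers
`tr f = f_+` and multiplicative transfers `nm f = f_•`. -/
structure TambaraFunctor (G : Type u) [Group G] where
  obj : FinGSet G → Type v
  [ring : ∀ X, CommRing (obj X)]
  res : ∀ {X Y : FinGSet G}, (X →[G] Y) → (obj Y →+* obj X)
  tr : ∀ {X Y : FinGSet G}, (X →[G] Y) → (obj X →+ obj Y)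
  nm : ∀ {X Y : FinGSet G}, (X →[G] Y) → (obj X →* obj Y)
  res_id : ∀ (X : FinGSet G) (t : obj X), res (MulActionHom.id G) t = t
  tr_id : ∀ (X : FinGSet G) (t : obj X), tr (MulActionHom.id G) t = t
  nm_id : ∀ (X : FinGSet G) (t : obj X), nm (MulActionHom.id G) t = t
  res_comp : ∀ {X Y Z : FinGSet G} (g : Y →[G] Z) (f : X →[G] Y) (t : obj Z),
    res (g.comp f) t = res f (res g t)
  tr_comp : ∀ {X Y Z : FinGSet G} (g : Y →[G] Z) (f : X →[G] Y) (t : obj X),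
    tr (g.comp f) t = tr g (tr f t)
  nm_comp : ∀ {X Y Z : FinGSet G} (g : Y →[G] Z) (f : X →[G] Y) (t : obj X),
    nm (g.comp f) t = nm g (nm f t)
  /-- additivity: `T(X ⨿ Y) → T(X) × T(Y)` is an isomorphism -/
  additive : ∀ X Y : FinGSet G, Function.Bijective
    (fun t : obj (FinGSet.sum X Y) => (res (inl X Y) t, res (inr X Y) t))
  /-- Mackey condition for `(T^*, T_+)` -/
  mackey_tr : ∀ {X' X Y' Y : FinGSet G} (ξ : X' →[G] X) (f' : X' →[G] Y') (f : X →[G] Y)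
    (η : Y' →[G] Y), IsPullback ξ f' f η → ∀ t : obj Y', res f (tr η t) = tr ξ (res f' t)
  /-- Mackey condition for `(T^*, T_•)` -/
  mackey_nm : ∀ {X' X Y' Y : FinGSet G} (ξ : X' →[G] X) (f' : X' →[G] Y') (f : X →[G] Y)
    (η : Y' →[G] Y), IsPullback ξ f' f η → ∀ t : obj Y', res f (nm η t) = nm ξ (res f' t)
  /-- distributive law -/
  distrib : ∀ {X Y A Z B : FinGSet G} (f : X →[G] Y) (p : A →[G] X) (lam : Z →[G] A)
    (rho : Z →[G] B) (q : B →[G] Y), IsExponential f p lam rho q →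
    ∀ t : obj A, nm f (tr p t) = tr q (nm rho (res lam t))

attribute [instance] TambaraFunctor.ring

/-- A morphism of Tambara functors. -/
structure TambaraFunctor.Hom {G : Type u} [Group G] (T : TambaraFunctor.{u, v} G)
    (T' : TambaraFunctor.{u, w} G) where
  app : ∀ X : FinGSet G, T.obj X →+* T'.obj X
  app_res : ∀ {X Y : FinGSet G} (f : X →[G] Y) (t : T.obj Y),
    app X (T.res f t) = T'.res f (app Y t)
  app_tr : ∀ {X Y : FinGSet G} (f : X →[G] Y) (t : T.obj X),
    app Y (T.tr f t) = T'.tr f (app X t)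
  app_nm : ∀ {X Y : FinGSet G} (f : X →[G] Y) (t : T.obj X),
    app Y (T.nm f t) = T'.nm f (app X t)

/-- An isomorphism of Tambara functors: a pair of mutually inverse morphisms. -/
structure TambaraFunctor.Iso {G : Type u} [Group G] (T : TambaraFunctor.{u, v} G)
    (T' : TambaraFunctor.{u, w} G) where
  hom : TambaraFunctor.Hom T T'
  inv : TambaraFunctor.Hom T' T
  hom_inv : ∀ (X : FinGSet G) (t : T.obj X), inv.app X (hom.app X t) = t
  inv_hom : ∀ (X : FinGSet G) (t : T'.obj X), hom.app X (inv.app X t) = t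

namespace TambaraFunctor

variable {G : Type u} [Group G] (T : TambaraFunctor.{u, v} G)

theorem subsingleton_of_isEmpty (X : FinGSet G) [hX : IsEmpty X] : Subsingleton (T.obj X) := by
  obtain ⟨t, ht⟩ := (T.additive X X).2 (0, 1)
  have h : inl X X = inr X X := by ext x; exact hX.elim x
  have h0 : T.res (inl X X) t = 0 := congrArg Prod.fst ht
  have h1 : T.res (inr X X) t = 1 := congrArg Prod.snd ht
  rw [h, h1] at h0
  exact subsingleton_of_zero_eq_one h0.symm

theorem res_nm_of_injective {X Y : FinGSet G} (f : X →[G] Y) (hf : Function.Injective f)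
    (t : T.obj X) : T.res f (T.nm f t) = t := by
  have h : IsPullback (MulActionHom.id G : X →[G] X) (MulActionHom.id G) f f :=
    ⟨fun _ => rfl, fun x y hxy => ⟨x, ⟨rfl, hf hxy⟩, fun z hz => hz.1⟩⟩
  rw [T.mackey_nm _ _ _ _ h, T.res_id, T.nm_id]

theorem res_nm_of_disjoint {X Z Y : FinGSet G} (f : X →[G] Y) (g : Z →[G] Y)
    (h : ∀ x z, f x ≠ g z) (t : T.obj Z) : T.res f (T.nm g t) = 1 := by
  have hp : IsPullback (pbFst f g) (pbSnd f g) f g :=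
    ⟨fun p => p.2, fun x z hxz => (h x z hxz).elim⟩
  have : IsEmpty (pb f g) := ⟨fun p => h _ _ p.2⟩
  have := T.subsingleton_of_isEmpty (pb f g)
  rw [T.mackey_nm _ _ _ _ hp, Subsingleton.elim (T.res (pbSnd f g) t) 1, map_one]

/-- The inverse of a bijective `G`-map. -/
noncomputable def invMap {X Y : FinGSet G} (f : X →[G] Y) (hf : Function.Bijective f) :
    Y →[G] X :=
  MulActionHom.inverse f (Equiv.ofBijective f hf).symm (Equiv.ofBijective f hf).left_inv
    (Equiv.ofBijective f hf).right_inv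

theorem res_injective_of_bijective {X Y : FinGSet G} (f : X →[G] Y) (hf : Function.Bijective f) :
    Function.Injective (T.res f) := by
  intro s t hst
  have h : f.comp (invMap f hf) = MulActionHom.id G := by
    ext y; exact (Equiv.ofBijective f hf).right_inv y
  rw [← T.res_id _ s, ← T.res_id _ t, ← h, T.res_comp, T.res_comp, hst]

theorem nm_res_of_bijective {X Y : FinGSet G} (f : X →[G] Y) (hf : Function.Bijective f)
    (t : T.obj Y) : T.nm f (T.res f t) = t :=
  T.res_injective_of_bijective f hf (T.res_nm_of_injective f hf.1 _)

/-- Elements of `T(P)` are determined by their restrictions to two parts that cover `P`. -/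
theorem ext_of_cover {X Z P : FinGSet G} (i : X →[G] P) (j : Z →[G] P)
    (hi : Function.Injective i) (hj : Function.Injective j) (hd : ∀ x z, i x ≠ j z)
    (hc : ∀ p, (∃ x, i x = p) ∨ ∃ z, j z = p) {s t : T.obj P}
    (h1 : T.res i s = T.res i t) (h2 : T.res j s = T.res j t) : s = t := by
  let e : FinGSet.sum X Z →[G] P := ⟨Sum.elim i j, by
    rintro g (x | z)
    · exact map_smul i g x
    · exact map_smul j g z⟩
  have he : Function.Bijective e := by
    constructor
    · rintro (x | x) (y | y) hxy
      · exact congrArg Sum.inl (hi hxy)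
      · exact (hd _ _ hxy).elim
      · exact (hd _ _ hxy.symm).elim
      · exact congrArg Sum.inr (hj hxy)
    · intro p
      rcases hc p with ⟨x, hx⟩ | ⟨z, hz⟩
      · exact ⟨Sum.inl x, hx⟩
      · exact ⟨Sum.inr z, hz⟩
  apply T.res_injective_of_bijective e he
  apply (T.additive X Z).1
  have hl : e.comp (inl X Z) = i := by ext; rfl
  have hr : e.comp (inr X Z) = j := by ext; rfl
  simp only [← T.res_comp, hl, hr, h1, h2]

theorem eq_nm_mul_nm {X Z P : FinGSet G} (i : X →[G] P) (j : Z →[G] P)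
    (hi : Function.Injective i) (hj : Function.Injective j) (hd : ∀ x z, i x ≠ j z)
    (hc : ∀ p, (∃ x, i x = p) ∨ ∃ z, j z = p) (t : T.obj P) :
    t = T.nm i (T.res i t) * T.nm j (T.res j t) := by
  apply T.ext_of_cover i j hi hj hd hc
  · rw [map_mul, T.res_nm_of_injective i hi, T.res_nm_of_disjoint i j hd, mul_one]
  · rw [map_mul, T.res_nm_of_injective j hj,
      T.res_nm_of_disjoint j i (fun z x h => hd x z h.symm), one_mul]

/-- `s` divides `f^* f_• s`. -/
theorem exists_mul_eq_res_nm {X Y : FinGSet G} (f : X →[G] Y) (s : T.obj X) :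
    ∃ a, a * s = T.res f (T.nm f s) := by
  have hp : IsPullback (pbFst f f) (pbSnd f f) f f :=
    ⟨fun p => p.2, fun x y h => ⟨⟨(x, y), h⟩, ⟨rfl, rfl⟩, fun p hp =>
      Subtype.ext (Prod.ext hp.1 hp.2)⟩⟩
  rw [T.mackey_nm _ _ _ _ hp]
  let i : X →[G] pb f f := ⟨fun x => ⟨(x, x), rfl⟩, fun _ _ => rfl⟩
  have hZ : ∀ (g : G) (p : pb f f), p.1.1 ≠ p.1.2 → (g • p).1.1 ≠ (g • p).1.2 :=
    fun g p h h' => h (MulAction.injective g h')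
  let j := subVal (pb f f) (fun p => p.1.1 ≠ p.1.2) hZ
  have hij := T.eq_nm_mul_nm i j (fun x y h => congrArg (fun p => p.1.1) h)
    (fun x y h => Subtype.ext h) (fun x z h => z.2 (by
      have : j z = i x := h.symm
      change (j z).1.1 = (j z).1.2
      rw [this]; rfl))
    (fun p => by
      by_cases h : p.1.1 = p.1.2
      · exact Or.inl ⟨p.1.1, Subtype.ext (Prod.ext rfl h)⟩
      · exact Or.inr ⟨⟨p, h⟩, rfl⟩)
    (T.res (pbSnd f f) s)
  refine ⟨T.nm ((pbFst f f).comp j) (T.res j (T.res (pbSnd f f) s)), ?_⟩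
  have h1 : (pbFst f f).comp i = MulActionHom.id G := by ext; rfl
  have h2 : (pbSnd f f).comp i = MulActionHom.id G := by ext; rfl
  conv_rhs => rw [hij]
  rw [map_mul, ← T.nm_comp, ← T.nm_comp, ← T.res_comp _ i, h1, h2, T.res_id, T.nm_id, mul_comm]

/-! ### Semi-Mackey subfunctors of the multiplicative part -/

/-- A semi-Mackey subfunctor of `T^μ = (T^*, T_•)`. -/
structure MulSubfunctor where
  carrier : ∀ X : FinGSet G, Submonoid (T.obj X)
  res_mem : ∀ {X Y : FinGSet G} (f : X →[G] Y) {t}, t ∈ carrier Y → T.res f t ∈ carrier X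
  nm_mem : ∀ {X Y : FinGSet G} (f : X →[G] Y) {t}, t ∈ carrier X → T.nm f t ∈ carrier Y

variable {T}

/-- For `S ⊆ T(G/e)`, the submonoid `S₀ = (pt_{G/e}^*)⁻¹(S)` of `T(G/G)`. -/
def baseSubmonoid [Finite G] (S : Submonoid (T.obj (free G))) : Submonoid (T.obj (point G)) :=
  S.comap (T.res (toPoint (free G))).toMonoidHom

/-- For transitive `X`, the submonoid `𝒰_S(X) = (pt_X^*(S₀))^~` of `T(X)`, where `~` is the
saturation. -/
def maxSubmonoid [Finite G] (S : Submonoid (T.obj (free G))) (X : FinGSet G) :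
    Submonoid (T.obj X) :=
  ((baseSubmonoid S).map (T.res (toPoint X)).toMonoidHom).saturation.toSubmonoid

theorem mem_maxSubmonoid [Finite G] {S : Submonoid (T.obj (free G))} {X : FinGSet G}
    {t : T.obj X} : t ∈ maxSubmonoid S X ↔
      ∃ a r, T.res (toPoint (free G)) r ∈ S ∧ t * a = T.res (toPoint X) r := by
  change t ∈ Submonoid.saturation _ ↔ _
  rw [Submonoid.mem_saturation_iff]
  constructor
  · rintro ⟨a, r, hr, h⟩
    exact ⟨a, r, hr, h.symm⟩
  · rintro ⟨a, r, hr, h⟩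
    exact ⟨a, r, hr, h.symm⟩

theorem res_mem_maxSubmonoid [Finite G] (S : Submonoid (T.obj (free G))) {X Y : FinGSet G}
    (f : X →[G] Y) {t : T.obj Y} (ht : t ∈ maxSubmonoid S Y) :
    T.res f t ∈ maxSubmonoid S X := by
  rw [mem_maxSubmonoid] at ht ⊢
  obtain ⟨a, r, hr, h⟩ := ht
  refine ⟨T.res f a, r, hr, ?_⟩
  rw [← map_mul, h, ← T.res_comp]
  rfl

/-- Norms of `u` along the translates of a subset of `X`. -/
theorem nm_res_free_mem [Finite G] (S : Submonoid (T.obj (free G))) (X : FinGSet G)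
    (u : T.obj (free G)) (hu : u ∈ S) :
    T.nm (⟨fun p => p.1, fun _ _ => rfl⟩ : prod (free G) X →[G] free G)
      (T.res (⟨fun p => p.1, fun _ _ => rfl⟩ : prod (free G) X →[G] free G) u) ∈ S := by
  classical
  let W : FinGSet G := prod (free G) X
  let π : W →[G] free G := ⟨fun p => p.1, fun _ _ => rfl⟩
  have hinv : ∀ s : Set X, ∀ (g : G) (p : W), (p.1 : G)⁻¹ • p.2 ∈ s →
      ((g • p).1 : G)⁻¹ • (g • p).2 ∈ s := by
    intro s g p h
    have : ((g • p).1 : G)⁻¹ • (g • p).2 = (p.1 : G)⁻¹ • p.2 := by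
      change (g * p.1)⁻¹ • (g • p.2) = _
      rw [mul_inv_rev, mul_smul, inv_smul_smul]
    rw [this]; exact h
  let V (s : Set X) : FinGSet G := sub W (fun p => (p.1 : G)⁻¹ • p.2 ∈ s) (hinv s)
  let v (s : Set X) : V s →[G] W := subVal W _ (hinv s)
  have key : ∀ s : Set X, s.Finite → T.nm (π.comp (v s)) (T.res (π.comp (v s)) u) ∈ S := by
    intro s hs
    induction s, hs using Set.Finite.induction_on with
    | empty =>
      have : IsEmpty (V ∅) := ⟨fun p => p.2⟩
      have := T.subsingleton_of_isEmpty (V ∅)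
      rw [Subsingleton.elim (T.res (π.comp (v ∅)) u) 1, map_one]
      exact one_mem _
    | @insert x s hx _ ih =>
      let i : V {x} →[G] V (insert x s) :=
        ⟨fun p => ⟨p.1, Set.mem_insert_iff.2 (Or.inl p.2)⟩, fun _ _ => rfl⟩
      let j : V s →[G] V (insert x s) :=
        ⟨fun p => ⟨p.1, Set.mem_insert_iff.2 (Or.inr p.2)⟩, fun _ _ => rfl⟩
      have hij := T.eq_nm_mul_nm i j (fun p q h => Subtype.ext (congrArg (fun r => r.1) h))
        (fun p q h => Subtype.ext (congrArg (fun r => r.1) h))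
        (fun p q h => hx (by
          have h1 : p.1 = q.1 := congrArg (fun r => r.1) h
          have hp : (p.1.1 : G)⁻¹ • p.1.2 = x := p.2
          have hq : (q.1.1 : G)⁻¹ • q.1.2 ∈ s := q.2
          rw [← h1, hp] at hq
          exact hq))
        (fun p => by
          rcases Set.mem_insert_iff.1 p.2 with h | h
          · exact Or.inl ⟨⟨p.1, h⟩, rfl⟩
          · exact Or.inr ⟨⟨p.1, h⟩, rfl⟩)
        (T.res (π.comp (v (insert x s))) u)
      rw [hij, map_mul, ← T.nm_comp, ← T.nm_comp, ← T.res_comp, ← T.res_comp]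
      refine mul_mem ?_ ih
      have hb : Function.Bijective (π.comp (v {x})) := by
        constructor
        · rintro ⟨⟨g, y⟩, hp⟩ ⟨⟨g', y'⟩, hq⟩ h
          have h : g = g' := h
          subst h
          have hp : g⁻¹ • y = x := hp
          have hq : g⁻¹ • y' = x := hq
          have : y = y' := MulAction.injective _ (hp.trans hq.symm)
          subst this; rfl
        · intro g
          exact ⟨⟨(g, g • x), inv_smul_smul g x⟩, rfl⟩
      have := T.nm_res_of_bijective _ hb u
      change T.nm (π.comp (v {x})) (T.res (π.comp (v {x})) u) ∈ S
      rwa [this]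
  have h := key Set.univ Set.finite_univ
  have hb : Function.Bijective (v Set.univ) :=
    ⟨fun p q h => Subtype.ext h, fun p => ⟨⟨p, Set.mem_univ _⟩, rfl⟩⟩
  rw [T.nm_comp, T.res_comp, T.nm_res_of_bijective _ hb] at h
  exact h

theorem nm_mem_maxSubmonoid [Finite G] (S : Submonoid (T.obj (free G))) {X Y : FinGSet G}
    (f : X →[G] Y) {t : T.obj X} (ht : t ∈ maxSubmonoid S X) :
    T.nm f t ∈ maxSubmonoid S Y := by
  rw [mem_maxSubmonoid] at ht ⊢
  obtain ⟨a, r, hr, h⟩ := ht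
  obtain ⟨b, hb⟩ := T.exists_mul_eq_res_nm (toPoint Y) (T.nm f (T.res (toPoint X) r))
  refine ⟨T.nm f a * b, T.nm (toPoint Y) (T.nm f (T.res (toPoint X) r)), ?_, ?_⟩
  · rw [← T.nm_comp]
    let π : prod (free G) X →[G] free G := ⟨fun p => p.1, fun _ _ => rfl⟩
    let π' : prod (free G) X →[G] X := ⟨fun p => p.2, fun _ _ => rfl⟩
    have hp : IsPullback π π' (toPoint (free G)) ((toPoint Y).comp f) :=
      ⟨fun _ => rfl, fun x y _ => ⟨(x, y), ⟨rfl, rfl⟩, fun p hp => Prod.ext hp.1 hp.2⟩⟩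
    rw [T.mackey_nm _ _ _ _ hp, ← T.res_comp]
    have := nm_res_free_mem S X _ hr
    rw [← T.res_comp] at this
    exact this
  · rw [← hb, ← h, map_mul]
    ring

/-- An element whose restrictions to all transitive `Z` lie in `maxSubmonoid S Z` lies in
`maxSubmonoid S X`. -/
theorem mem_maxSubmonoid_of_forall [Finite G] (S : Submonoid (T.obj (free G))) :
    ∀ (n : ℕ) (X : FinGSet G), Nat.card X = n → ∀ t : T.obj X,
      (∀ (Z : FinGSet G) (h : Z →[G] X), Z.IsTransitive → T.res h t ∈ maxSubmonoid S Z) →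
      t ∈ maxSubmonoid S X := by
  intro n
  induction n using Nat.strong_induction_on with
  | _ n ih =>
  intro X hX t ht
  rcases isEmpty_or_nonempty X with hE | ⟨⟨x⟩⟩
  · have := T.subsingleton_of_isEmpty X
    rw [Subsingleton.elim t 1]
    exact one_mem _
  have hO : ∀ (g : G) (y : X), y ∈ MulAction.orbit G x → g • y ∈ MulAction.orbit G x :=
    fun g y h => MulAction.mem_orbit_of_mem_orbit g h
  have hC : ∀ (g : G) (y : X), y ∉ MulAction.orbit G x → g • y ∉ MulAction.orbit G x :=
    fun g y h h' => h (by simpa using MulAction.mem_orbit_of_mem_orbit g⁻¹ h')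
  let i := subVal X _ hO
  let j := subVal X _ hC
  have hi : T.res i t ∈ maxSubmonoid S _ := by
    apply ht
    refine ⟨⟨⟨x, MulAction.mem_orbit_self x⟩⟩, ?_⟩
    rintro ⟨_, g, rfl⟩ ⟨_, g', rfl⟩
    refine ⟨g' * g⁻¹, Subtype.ext ?_⟩
    change (g' * g⁻¹) • g • x = g' • x
    rw [mul_smul, inv_smul_smul]
  have hj : T.res j t ∈ maxSubmonoid S _ := by
    refine ih _ ?_ _ rfl _ ?_
    · rw [← hX]
      change Nat.card {y : X // y ∉ MulAction.orbit G x} < Nat.card X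
      exact Finite.card_subtype_lt (x := x) (fun h => h (MulAction.mem_orbit_self x))
    · intro Z h hZ
      rw [← T.res_comp]
      exact ht _ _ hZ
  rw [mem_maxSubmonoid] at hi hj ⊢
  obtain ⟨a, r, hr, ha⟩ := hi
  obtain ⟨b, r', hr', hb⟩ := hj
  have hinj_i : Function.Injective i := fun p q h => Subtype.ext h
  have hinj_j : Function.Injective j := fun p q h => Subtype.ext h
  have hd : ∀ p q, i p ≠ j q := by
    intro p q h
    have h : p.1 = q.1 := h
    exact q.2 (h ▸ p.2)
  refine ⟨T.nm i (a * T.res (toPoint _) r') * T.nm j (b * T.res (toPoint _) r), r * r', ?_, ?_⟩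
  · rw [map_mul]
    exact mul_mem hr hr'
  · apply T.ext_of_cover i j hinj_i hinj_j hd
    · intro p
      by_cases hp : p ∈ MulAction.orbit G x
      · exact Or.inl ⟨⟨p, hp⟩, rfl⟩
      · exact Or.inr ⟨⟨p, hp⟩, rfl⟩
    · rw [map_mul, map_mul, T.res_nm_of_injective i hinj_i, T.res_nm_of_disjoint i j hd, mul_one,
        ← mul_assoc, ha, ← T.res_comp, map_mul]
      rfl
    · rw [map_mul, map_mul, T.res_nm_of_injective j hinj_j,
        T.res_nm_of_disjoint j i (fun p q h => hd q p h.symm), one_mul,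
        ← mul_assoc, hb, ← T.res_comp, map_mul, mul_comm]
      rfl

/-- The semi-Mackey subfunctor `𝒰_S` of `T^μ`: on transitive `X` it is `(pt_X^*(S₀))^~`, and an
element over an arbitrary `X` belongs to it if its restriction to every orbit does (equivalently,
its restriction along every `G`-map from a transitive `G`-set). -/
def maxSub [Finite G] (S : Submonoid (T.obj (free G))) : MulSubfunctor T where
  carrier X :=
    { carrier := {t | ∀ (Z : FinGSet G) (h : Z →[G] X), Z.IsTransitive →
        T.res h t ∈ maxSubmonoid S Z}
      one_mem' := fun Z h _ => by rw [map_one]; exact one_mem _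
      mul_mem' := fun ha hb Z h hZ => by rw [map_mul]; exact mul_mem (ha Z h hZ) (hb Z h hZ) }
  res_mem f t ht Z h hZ := by
    rw [← T.res_comp]
    exact ht Z _ hZ
  nm_mem f t ht Z h _ :=
    res_mem_maxSubmonoid S h (nm_mem_maxSubmonoid S f (mem_maxSubmonoid_of_forall S _ _ rfl t ht))

end TambaraFunctor

namespace TambaraFunctor

variable {G : Type u} [Group G] (T : TambaraFunctor.{u, v} G)

/-- The codiagonal `X ⨿ X → X`. -/
def fold (X : FinGSet G) : FinGSet.sum X X →[G] X :=
  ⟨Sum.elim id id, by rintro g (x | x) <;> rfl⟩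

theorem nm_fold (X : FinGSet G) (t : T.obj (FinGSet.sum X X)) :
    T.nm (fold X) t = T.res (inl X X) t * T.res (inr X X) t := by
  have h := T.eq_nm_mul_nm (inl X X) (inr X X) Sum.inl_injective Sum.inr_injective
    (fun x z h => Sum.inl_ne_inr h)
    (fun p => match p with
      | Sum.inl x => Or.inl ⟨x, rfl⟩
      | Sum.inr x => Or.inr ⟨x, rfl⟩) t
  have h1 : (fold X).comp (inl X X) = MulActionHom.id G := by ext; rfl
  have h2 : (fold X).comp (inr X X) = MulActionHom.id G := by ext; rfl
  conv_lhs => rw [h]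
  rw [map_mul, ← T.nm_comp, ← T.nm_comp, h1, h2, T.nm_id, T.nm_id]

/-- The projection formula. -/
theorem tr_mul_res {X Y : FinGSet G} (f : X →[G] Y) (x : T.obj X) (y : T.obj Y) :
    T.tr f (x * T.res f y) = T.tr f x * y := by
  obtain ⟨u, hu⟩ := (T.additive X Y).2 (x, y)
  have hx : T.res (inl X Y) u = x := congrArg Prod.fst hu
  have hy : T.res (inr X Y) u = y := congrArg Prod.snd hu
  let p : FinGSet.sum X Y →[G] FinGSet.sum Y Y :=
    ⟨Sum.map f id, by
      rintro g (a | a)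
      · exact congrArg Sum.inl (map_smul f g a)
      · rfl⟩
  let lam : FinGSet.sum X X →[G] FinGSet.sum X Y :=
    ⟨Sum.map id f, by
      rintro g (a | a)
      · rfl
      · exact congrArg Sum.inr (map_smul f g a)⟩
  have hE : IsExponential (fold Y) p lam (fold X) f := by
    refine ⟨⟨?_, ?_⟩, ?_⟩
    · rintro (a | a) <;> rfl
    · rintro (b | b) a h
      · have h : b = f a := h
        subst h
        refine ⟨Sum.inl a, ⟨rfl, rfl⟩, ?_⟩
        rintro (c | c) ⟨h1, h2⟩
        · exact congrArg Sum.inl h2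
        · exact (Sum.inr_ne_inl h1).elim
      · have h : b = f a := h
        subst h
        refine ⟨Sum.inr a, ⟨rfl, rfl⟩, ?_⟩
        rintro (c | c) ⟨h1, h2⟩
        · exact (Sum.inl_ne_inr h1).elim
        · exact congrArg Sum.inr h2
    · intro b σ hσ
      have h1 := hσ ⟨Sum.inl b, rfl⟩
      have h2 := hσ ⟨Sum.inr b, rfl⟩
      rcases hs : σ ⟨Sum.inl b, rfl⟩ with a | a
      · rcases hs' : σ ⟨Sum.inr b, rfl⟩ with a' | a'
        · rw [hs'] at h2
          exact (Sum.inl_ne_inr h2).elim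
        · rw [hs] at h1
          rw [hs'] at h2
          have h1 : f a = b := Sum.inl_injective h1
          have h2 : a' = b := Sum.inr_injective h2
          refine ⟨a, ⟨h1, ?_⟩, ?_⟩
          · rintro (c | c) ⟨d | d, hd⟩ hc hcd
            · have hc : c = a := hc
              subst hc
              have hd' : d = b := hd
              subst hd'
              exact hs.symm
            · exact (Sum.inl_ne_inr hcd).elim
            · exact (Sum.inr_ne_inl hcd).elim
            · have hc : c = a := hc
              subst hc
              have hd' : d = b := hd
              subst hd'
              have h2 : a' = d := h2
              subst h2
              exact (congrArg Sum.inr h1).trans hs'.symm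
          · rintro c ⟨hc, hc'⟩
            have := hc' (Sum.inl c) ⟨Sum.inl b, rfl⟩ rfl (congrArg Sum.inl hc)
            rw [hs] at this
            exact Sum.inl_injective this
      · rw [hs] at h1
        exact (Sum.inr_ne_inl h1).elim
  have h := T.distrib _ _ _ _ _ hE u
  have hP1 : IsPullback f (inl X Y) (inl Y Y) p := by
    refine ⟨fun _ => rfl, ?_⟩
    rintro b (a | a) h
    · exact ⟨a, ⟨(Sum.inl_injective h).symm, rfl⟩, fun c hc => Sum.inl_injective hc.2⟩
    · exact (Sum.inl_ne_inr h).elim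
  have hP2 : IsPullback (MulActionHom.id G) (inr X Y) (inr Y Y) p := by
    refine ⟨fun _ => rfl, ?_⟩
    rintro b (a | a) h
    · exact (Sum.inr_ne_inl h).elim
    · exact ⟨a, ⟨(Sum.inr_injective h).symm, rfl⟩, fun c hc => Sum.inr_injective hc.2⟩
  have e1 : lam.comp (inl X X) = inl X Y := by ext; rfl
  have e2 : lam.comp (inr X X) = (inr X Y).comp f := by ext; rfl
  rw [nm_fold, nm_fold, T.mackey_tr _ _ _ _ hP1, T.mackey_tr _ _ _ _ hP2, T.tr_id,
    ← T.res_comp, ← T.res_comp, e1, e2, T.res_comp, hx, hy] at h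
  exact h.symm

/-! ### Fractions -/

variable {T} (S : MulSubfunctor T)

namespace MulSubfunctor

/-- Restriction `f^*(y/t) = f^*(y)/f^*(t)` of the fraction. -/
noncomputable def fracRes {X Y : FinGSet G} (f : X →[G] Y) :
    Localization (S.carrier Y) →+* Localization (S.carrier X) :=
  IsLocalization.map (Localization (S.carrier X)) (T.res f)
    (show S.carrier Y ≤ (S.carrier X).comap (T.res f) from fun _ h => S.res_mem f h)

theorem fracRes_mk {X Y : FinGSet G} (f : X →[G] Y) (y : T.obj Y) (t : S.carrier Y) :
    S.fracRes f (Localization.mk y t) =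
      Localization.mk (T.res f y) ⟨T.res f t, S.res_mem f t.2⟩ := by
  rw [Localization.mk_eq_mk'_apply, Localization.mk_eq_mk'_apply]
  exact IsLocalization.map_mk' _ _ _

/-- Multiplicative transfer `f_•(x/s) = f_•(x)/f_•(s)` of the fraction. -/
noncomputable def fracNm {X Y : FinGSet G} (f : X →[G] Y) :
    Localization (S.carrier X) →* Localization (S.carrier Y) :=
  (Localization.monoidOf (S.carrier X)).map (g := T.nm f) (T := S.carrier Y)
    (fun s => S.nm_mem f s.2) (Localization.monoidOf (S.carrier Y))

theorem fracNm_mk {X Y : FinGSet G} (f : X →[G] Y) (x : T.obj X) (s : S.carrier X) :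
    S.fracNm f (Localization.mk x s) =
      Localization.mk (T.nm f x) ⟨T.nm f s, S.nm_mem f s.2⟩ := by
  rw [Localization.mk_eq_monoidOf_mk'_apply, Localization.mk_eq_monoidOf_mk'_apply]
  exact Submonoid.LocalizationMap.map_mk' _ _ _ _

/-- Fractions `f_+(a x) / s̄` with `f^*(s̄) = a s` depend only on `x/s`. -/
theorem mk_tr_eq {X Y : FinGSet G} (f : X →[G] Y) {x x' a a' : T.obj X} {s s' : S.carrier X}
    {r r' : S.carrier Y} (ha : a * s = T.res f r) (ha' : a' * s' = T.res f r')
    (h : Localization.mk x s = Localization.mk x' s') :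
    Localization.mk (T.tr f (a * x)) r = Localization.mk (T.tr f (a' * x')) r' := by
  rw [Localization.mk_eq_mk_iff, Localization.r_iff_exists] at h ⊢
  obtain ⟨c, hc⟩ := h
  obtain ⟨b, hb⟩ := T.exists_mul_eq_res_nm f (c : T.obj X)
  refine ⟨⟨T.nm f c, S.nm_mem f c.2⟩, ?_⟩
  simp only at hc ⊢
  have e1 : T.nm f (c : T.obj X) * ((r' : T.obj Y) * T.tr f (a * x)) =
      T.tr f (a * x * T.res f (T.nm f c * r')) := by
    rw [T.tr_mul_res]; ring
  have e2 : T.nm f (c : T.obj X) * ((r : T.obj Y) * T.tr f (a' * x')) =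
      T.tr f (a' * x' * T.res f (T.nm f c * r)) := by
    rw [T.tr_mul_res]; ring
  rw [e1, e2, map_mul (T.res f), map_mul (T.res f), ← hb, ← ha, ← ha']
  congr 1
  linear_combination (a * a' * b) * hc

/-- Additive transfer of the fraction: `f_+(x/s) = f_+(a x)/f_•(s)` for any `a` with
`f^*(f_•(s)) = a s`. -/
noncomputable def fracTrFun {X Y : FinGSet G} (f : X →[G] Y) (z : Localization (S.carrier X)) :
    Localization (S.carrier Y) :=
  Localization.liftOn z
    (fun x s => Localization.mk (T.tr f ((T.exists_mul_eq_res_nm f (s : T.obj X)).choose * x))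
      ⟨T.nm f s, S.nm_mem f s.2⟩)
    (fun {_ _ s s'} h => S.mk_tr_eq f (T.exists_mul_eq_res_nm f (s : T.obj X)).choose_spec
      (T.exists_mul_eq_res_nm f (s' : T.obj X)).choose_spec (Localization.mk_eq_mk_iff.2 h))

theorem fracTrFun_mk {X Y : FinGSet G} (f : X →[G] Y) {x a : T.obj X} {s : S.carrier X}
    {r : S.carrier Y} (ha : a * s = T.res f r) :
    S.fracTrFun f (Localization.mk x s) = Localization.mk (T.tr f (a * x)) r :=
  S.mk_tr_eq f (T.exists_mul_eq_res_nm f (s : T.obj X)).choose_spec ha rfl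

/-- Every fraction over `X` can be written with a denominator coming from `Y`. -/
theorem exists_denominator {X Y : FinGSet G} (f : X →[G] Y) (s : S.carrier X) :
    ∃ (a : T.obj X) (r : S.carrier Y), a * s = T.res f r :=
  let ⟨a, ha⟩ := T.exists_mul_eq_res_nm f (s : T.obj X)
  ⟨a, ⟨_, S.nm_mem f s.2⟩, ha⟩

/-- Additive transfer of the fraction, as an additive homomorphism. -/
noncomputable def fracTr {X Y : FinGSet G} (f : X →[G] Y) :
    Localization (S.carrier X) →+ Localization (S.carrier Y) where
  toFun := S.fracTrFun f
  map_zero' := by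
    rw [← Localization.mk_zero 1, S.fracTrFun_mk f (a := 1) (r := 1)
      (by simp), mul_zero, map_zero, Localization.mk_zero]
  map_add' z z' := by
    induction z using Localization.induction_on with | _ z
    induction z' using Localization.induction_on with | _ z'
    obtain ⟨x, s⟩ := z
    obtain ⟨x', s'⟩ := z'
    obtain ⟨a, r, ha⟩ := S.exists_denominator f s
    obtain ⟨a', r', ha'⟩ := S.exists_denominator f s'
    have h : (a * a') * ((s * s' : S.carrier X) : T.obj X) =
        T.res f ((r * r' : S.carrier Y) : T.obj Y) := by
      rw [Submonoid.coe_mul, Submonoid.coe_mul, map_mul, ← ha, ← ha']; ring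
    rw [Localization.add_mk, S.fracTrFun_mk f h, S.fracTrFun_mk f ha, S.fracTrFun_mk f ha',
      Localization.add_mk]
    congr 1
    rw [mul_comm (r : T.obj Y), mul_comm (r' : T.obj Y), ← T.tr_mul_res, ← T.tr_mul_res, ← map_add,
      ← ha, ← ha']
    congr 1
    ring

theorem fracTr_mk {X Y : FinGSet G} (f : X →[G] Y) {x a : T.obj X} {s : S.carrier X}
    {r : S.carrier Y} (ha : a * s = T.res f r) :
    S.fracTr f (Localization.mk x s) = Localization.mk (T.tr f (a * x)) r := by
  change S.fracTrFun f (Localization.mk x s) = _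
  exact S.fracTrFun_mk f ha

theorem frac_additive (X Y : FinGSet G) : Function.Bijective
    (fun t : Localization (S.carrier (FinGSet.sum X Y)) =>
      (S.fracRes (inl X Y) t, S.fracRes (inr X Y) t)) := by
  have hl := T.res_nm_of_injective (inl X Y) Sum.inl_injective
  have hr := T.res_nm_of_injective (inr X Y) Sum.inr_injective
  have hlr := T.res_nm_of_disjoint (inl X Y) (inr X Y) (fun x z h => Sum.inl_ne_inr h)
  have hrl := T.res_nm_of_disjoint (inr X Y) (inl X Y) (fun x z h => Sum.inr_ne_inl h)
  constructor
  · intro z z' h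
    induction z using Localization.induction_on with | _ z
    induction z' using Localization.induction_on with | _ z'
    obtain ⟨x, s⟩ := z
    obtain ⟨x', s'⟩ := z'
    have h1 := congrArg Prod.fst h
    have h2 := congrArg Prod.snd h
    simp only [fracRes_mk] at h1 h2
    rw [Localization.mk_eq_mk_iff, Localization.r_iff_exists] at h1 h2 ⊢
    obtain ⟨c, hc⟩ := h1
    obtain ⟨d, hd⟩ := h2
    refine ⟨⟨T.nm (inl X Y) c * T.nm (inr X Y) d,
      mul_mem (S.nm_mem _ c.2) (S.nm_mem _ d.2)⟩, ?_⟩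
    apply (T.additive X Y).1
    simp only [map_mul, hl, hr, hlr, hrl, one_mul, mul_one] at hc hd ⊢
    rw [hc, hd]
  · rintro ⟨z, z'⟩
    induction z using Localization.induction_on with | _ z
    induction z' using Localization.induction_on with | _ z'
    obtain ⟨x, s⟩ := z
    obtain ⟨x', s'⟩ := z'
    refine ⟨Localization.mk (T.nm (inl X Y) x * T.nm (inr X Y) x')
      ⟨T.nm (inl X Y) s * T.nm (inr X Y) s', mul_mem (S.nm_mem _ s.2) (S.nm_mem _ s'.2)⟩, ?_⟩
    simp only [fracRes_mk, map_mul, hl, hr, hlr, hrl, one_mul, mul_one]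

/-- The fraction `S⁻¹T` of a Tambara functor by a semi-Mackey subfunctor of `T^μ`. -/
noncomputable def frac : TambaraFunctor.{u, v} G where
  obj X := Localization (S.carrier X)
  res f := S.fracRes f
  tr f := S.fracTr f
  nm f := S.fracNm f
  res_id X z := by
    induction z using Localization.induction_on with | _ z
    rw [fracRes_mk]; simp only [T.res_id]
  tr_id X z := by
    induction z using Localization.induction_on with | _ z
    rw [S.fracTr_mk (a := 1) (r := z.2) _ (by rw [one_mul, T.res_id]), one_mul, T.tr_id]
  nm_id X z := by
    induction z using Localization.induction_on with | _ z
    rw [fracNm_mk]; simp only [T.nm_id]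
  res_comp g f z := by
    induction z using Localization.induction_on with | _ z
    rw [fracRes_mk, fracRes_mk, fracRes_mk]; simp only [T.res_comp]
  tr_comp g f z := by
    induction z using Localization.induction_on with | _ z
    obtain ⟨x, s⟩ := z
    obtain ⟨a, r, ha⟩ := S.exists_denominator f s
    obtain ⟨b, q, hb⟩ := S.exists_denominator g r
    have h : (T.res f b * a) * s = T.res (g.comp f) q := by
      rw [T.res_comp, ← hb, map_mul, mul_assoc, ha]
    rw [S.fracTr_mk f ha, S.fracTr_mk g hb, S.fracTr_mk _ h, T.tr_comp]
    congr 2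
    rw [mul_comm b, ← T.tr_mul_res]
    congr 1
    ring
  nm_comp g f z := by
    induction z using Localization.induction_on with | _ z
    rw [fracNm_mk, fracNm_mk, fracNm_mk]; simp only [T.nm_comp]
  additive := S.frac_additive
  mackey_tr ξ f' f η h z := by
    induction z using Localization.induction_on with | _ z
    obtain ⟨y, t⟩ := z
    obtain ⟨b, r, hb⟩ := S.exists_denominator η t
    have hc : f.comp ξ = η.comp f' := by ext x; exact h.1 x
    have h' : T.res f' b * ((⟨T.res f' t, S.res_mem f' t.2⟩ : S.carrier _) : T.obj _) =
        T.res ξ ((⟨T.res f r, S.res_mem f r.2⟩ : S.carrier _) : T.obj _) := by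
      change T.res f' b * T.res f' t = T.res ξ (T.res f r)
      rw [← map_mul, hb, ← T.res_comp, ← T.res_comp, hc]
    rw [S.fracTr_mk η hb, fracRes_mk, fracRes_mk, S.fracTr_mk ξ h', T.mackey_tr _ _ _ _ h, map_mul]
  mackey_nm ξ f' f η h z := by
    induction z using Localization.induction_on with | _ z
    rw [fracNm_mk, fracRes_mk, fracRes_mk, fracNm_mk]
    simp only [T.mackey_nm _ _ _ _ h]
  distrib f p lam rho q h z := by
    induction z using Localization.induction_on with | _ z
    obtain ⟨x, s⟩ := z
    obtain ⟨a, r, ha⟩ := S.exists_denominator p s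
    have h' : T.nm rho (T.res lam a) *
        ((⟨T.nm rho (T.res lam s), S.nm_mem rho (S.res_mem lam s.2)⟩ : S.carrier _) : T.obj _) =
        T.res q ((⟨T.nm f r, S.nm_mem f r.2⟩ : S.carrier _) : T.obj _) := by
      change T.nm rho (T.res lam a) * T.nm rho (T.res lam s) = T.res q (T.nm f r)
      have hpb : FinGSet.IsPullback rho (p.comp lam) q f :=
        ⟨fun z => (h.1.1 z).symm, fun b x hbx => by
          obtain ⟨z, hz, hz'⟩ := h.1.2 x b hbx.symm
          exact ⟨z, ⟨hz.2, hz.1⟩, fun w hw => hz' w ⟨hw.2, hw.1⟩⟩⟩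
      rw [← map_mul, ← map_mul, ha, ← T.res_comp, T.mackey_nm _ _ _ _ hpb]
    rw [S.fracTr_mk p ha, fracNm_mk, fracRes_mk, fracNm_mk, S.fracTr_mk q h']
    rw [T.distrib _ _ _ _ _ h, map_mul, map_mul]

end MulSubfunctor

end TambaraFunctor

/-! ### Fixed point functors -/

section FixedPoint

attribute [local instance] Fintype.ofFinite

variable (G : Type u) [Group G] (R : Type w) [CommRing R] [MulSemiringAction G R]

/-- The ring of `G`-maps from `X` to the `G`-ring `R`. -/
def gMaps (X : FinGSet G) : Subring (X → R) where
  carrier := {φ | ∀ (g : G) (x : X), φ (g • x) = g • φ x}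
  mul_mem' ha hb g x := by simp only [Pi.mul_apply, ha g x, hb g x, smul_mul']
  one_mem' g x := by simp
  add_mem' ha hb g x := by simp only [Pi.add_apply, ha g x, hb g x, smul_add]
  zero_mem' g x := by simp
  neg_mem' ha g x := by simp only [Pi.neg_apply, ha g x, smul_neg]

variable {G R}

/-- Translation by `g` between the fibres of a `G`-map over `y` and over `g • y`. -/
def fiberSMul {X Y : FinGSet G} (f : X →[G] Y) (g : G) (y : Y) :
    {x : X // f x = y} ≃ {x : X // f x = g • y} where
  toFun x := ⟨g • x.1, by rw [map_smul, x.2]⟩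
  invFun x := ⟨g⁻¹ • x.1, by rw [map_smul, x.2, inv_smul_smul]⟩
  left_inv x := Subtype.ext (inv_smul_smul g x.1)
  right_inv x := Subtype.ext (smul_inv_smul g x.1)

/-- The fibres of parallel sides of a pullback square are in bijection. -/
noncomputable def fiberEquiv {X' X Y' Y : FinGSet G} {ξ : X' →[G] X} {f' : X' →[G] Y'}
    {f : X →[G] Y} {η : Y' →[G] Y} (h : IsPullback ξ f' f η) (x : X) :
    {a : X' // ξ a = x} ≃ {b : Y' // η b = f x} :=
  Equiv.ofBijective (fun a => ⟨f' a.1, by rw [← h.1, a.2]⟩) (by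
    constructor
    · intro a b hab
      obtain ⟨c, _, hc⟩ := h.2 x (f' a.1) (by rw [← h.1, a.2])
      exact Subtype.ext ((hc a.1 ⟨a.2, rfl⟩).trans
        (hc b.1 ⟨b.2, (congrArg Subtype.val hab).symm⟩).symm)
    · intro b
      obtain ⟨c, hc, _⟩ := h.2 x b.1 b.2.symm
      exact ⟨⟨c, hc.1⟩, Subtype.ext hc.2⟩)

/-- The fibre of a composite is the union of the fibres. -/
def fiberComp {X Y Z : FinGSet G} (g : Y →[G] Z) (f : X →[G] Y) (z : Z) :
    (Σ y : {y : Y // g y = z}, {x : X // f x = y.1}) ≃ {x : X // g.comp f x = z} where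
  toFun p := ⟨p.2.1, (congrArg g p.2.2).trans p.1.2⟩
  invFun x := ⟨⟨f x.1, x.2⟩, ⟨x.1, rfl⟩⟩
  left_inv := by
    rintro ⟨⟨y, hy⟩, ⟨x, hx⟩⟩
    have hx' : f x = y := hx
    subst hx'
    rfl
  right_inv _ := rfl

/-- In an exponential diagram, points of `B` over `y` are sections of `p` over `f⁻¹(y)`. -/
theorem exists_section {X Y A Z B : FinGSet G} {f : X →[G] Y} {p : A →[G] X} {lam : Z →[G] A}
    {rho : Z →[G] B} {q : B →[G] Y} (h : IsExponential f p lam rho q) (y : Y) :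
    ∃ e : {b : B // q b = y} ≃ (∀ x : {x : X // f x = y}, {a : A // p a = x.1}),
      ∀ (b : {b : B // q b = y}) (z : Z) (x : {x : X // f x = y}),
        rho z = b.1 → p (lam z) = x.1 → lam z = (e b x).1 := by
  have hz : ∀ (b : {b : B // q b = y}) (x : {x : X // f x = y}), ∃ z : Z,
      p (lam z) = x.1 ∧ rho z = b.1 := fun b x => by
    obtain ⟨z, hz, _⟩ := h.1.2 x.1 b.1 (x.2.trans b.2.symm)
    exact ⟨z, hz⟩
  choose ζ hζ using hz
  have hu : ∀ (b : {b : B // q b = y}) (x : {x : X // f x = y}) (z : Z),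
      rho z = b.1 → p (lam z) = x.1 → z = ζ b x := fun b x z h1 h2 => by
    obtain ⟨z', _, hz'⟩ := h.1.2 x.1 b.1 (x.2.trans b.2.symm)
    exact (hz' z ⟨h2, h1⟩).trans (hz' _ (hζ b x)).symm
  let φ : {b : B // q b = y} → (∀ x : {x : X // f x = y}, {a : A // p a = x.1}) :=
    fun b x => ⟨lam (ζ b x), (hζ b x).1⟩
  have hφ : Function.Bijective φ := by
    constructor
    · intro b b' hbb
      obtain ⟨c, _, hc⟩ := h.2 y (fun x => (φ b x).1) (fun x => (φ b x).2)
      have h1 := hc b.1 ⟨b.2, fun z x hz hx => by rw [hu b x z hz hx]⟩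
      have h2 := hc b'.1 ⟨b'.2, fun z x hz hx => by rw [hu b' x z hz hx, hbb]⟩
      exact Subtype.ext (h1.trans h2.symm)
    · intro σ
      obtain ⟨b, ⟨hb, hbz⟩, _⟩ := h.2 y (fun x => (σ x).1) (fun x => (σ x).2)
      exact ⟨⟨b, hb⟩, funext fun x => Subtype.ext
        (hbz _ x (hζ ⟨b, hb⟩ x).2 (hζ ⟨b, hb⟩ x).1)⟩
  refine ⟨Equiv.ofBijective φ hφ, fun b z x h1 h2 => ?_⟩
  rw [hu b x z h1 h2]
  rfl

variable (G R)

/-- The fixed point functor `𝒫_R` of a `G`-ring `R`: `𝒫_R(X)` is the ring of `G`-maps `X → R`,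
restriction is composition, and the additive (multiplicative) transfer takes sums (products) over
fibres. -/
noncomputable def fixedPointFunctor : TambaraFunctor.{u, max u w} G where
  obj X := gMaps G R X
  res {X Y} f :=
    { toFun := fun φ => ⟨fun x => φ.1 (f x), fun g x =>
        (congrArg φ.1 (map_smul f g x)).trans (φ.2 g (f x))⟩
      map_one' := rfl
      map_mul' := fun _ _ => rfl
      map_zero' := rfl
      map_add' := fun _ _ => rfl }
  tr {X Y} f :=
    { toFun := fun φ => ⟨fun y => ∑ x : {x : X // f x = y}, φ.1 x.1, fun g y => by
        change ∑ x : {x : X // f x = g • y}, φ.1 x.1 = g • ∑ x : {x : X // f x = y}, φ.1 x.1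
        rw [Finset.smul_sum, ← Equiv.sum_comp (fiberSMul f g y)]
        exact Finset.sum_congr rfl fun x _ => φ.2 g x.1⟩
      map_zero' := Subtype.ext (funext fun y => Finset.sum_const_zero)
      map_add' := fun _ _ => Subtype.ext (funext fun y => Finset.sum_add_distrib) }
  nm {X Y} f :=
    { toFun := fun φ => ⟨fun y => ∏ x : {x : X // f x = y}, φ.1 x.1, fun g y => by
        change ∏ x : {x : X // f x = g • y}, φ.1 x.1 = g • ∏ x : {x : X // f x = y}, φ.1 x.1
        rw [Finset.smul_prod', ← Equiv.prod_comp (fiberSMul f g y)]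
        exact Finset.prod_congr rfl fun x _ => φ.2 g x.1⟩
      map_one' := Subtype.ext (funext fun y => Finset.prod_const_one)
      map_mul' := fun _ _ => Subtype.ext (funext fun y => Finset.prod_mul_distrib) }
  res_id X t := rfl
  tr_id X t := Subtype.ext (funext fun y => by
    have : Subsingleton {x : X // MulActionHom.id G x = y} :=
      ⟨fun a b => Subtype.ext (a.2.trans b.2.symm)⟩
    exact Finset.sum_eq_single (⟨y, rfl⟩ : {x : X // MulActionHom.id G x = y})
      (fun b _ hb => (hb (Subsingleton.elim _ _)).elim) (fun h => (h (@Finset.mem_univ _ (_) _)).elim))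
  nm_id X t := Subtype.ext (funext fun y => by
    have : Subsingleton {x : X // MulActionHom.id G x = y} :=
      ⟨fun a b => Subtype.ext (a.2.trans b.2.symm)⟩
    exact Finset.prod_eq_single (⟨y, rfl⟩ : {x : X // MulActionHom.id G x = y})
      (fun b _ hb => (hb (Subsingleton.elim _ _)).elim) (fun h => (h (@Finset.mem_univ _ (_) _)).elim))
  res_comp g f t := rfl
  tr_comp g f t := Subtype.ext (funext fun z => by
    refine Eq.trans ?_ (Fintype.sum_sigma
      (fun p : (Σ y : {y // g y = z}, {x // f x = y.1}) => t.1 p.2.1))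
    exact (Finset.sum_equiv (fiberComp g f z) (by simp) (fun _ _ => rfl)).symm)
  nm_comp g f t := Subtype.ext (funext fun z => by
    refine Eq.trans ?_ (Fintype.prod_sigma
      (fun p : (Σ y : {y // g y = z}, {x // f x = y.1}) => t.1 p.2.1))
    exact (Finset.prod_equiv (fiberComp g f z) (by simp) (fun _ _ => rfl)).symm)
  additive X Y := by
    constructor
    · intro s t h
      refine Subtype.ext (funext fun p => ?_)
      rcases p with x | y
      · exact congrFun (congrArg Subtype.val (congrArg Prod.fst h)) x
      · exact congrFun (congrArg Subtype.val (congrArg Prod.snd h)) y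
    · rintro ⟨s, t⟩
      refine ⟨⟨Sum.elim s.1 t.1, ?_⟩, rfl⟩
      rintro g (x | y)
      · exact s.2 g x
      · exact t.2 g y
  mackey_tr ξ f' f η h t := Subtype.ext (funext fun x =>
    (Equiv.sum_comp (fiberEquiv h x) (fun b => t.1 b.1)).symm)
  mackey_nm ξ f' f η h t := Subtype.ext (funext fun x =>
    (Equiv.prod_comp (fiberEquiv h x) (fun b => t.1 b.1)).symm)
  distrib {X Y A Z B} f p lam rho q h t := Subtype.ext (funext fun y => by
    obtain ⟨e, he⟩ := exists_section h y
    change ∏ x : {x : X // f x = y}, ∑ a : {a : A // p a = x.1}, t.1 a.1 =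
      ∑ b : {b : B // q b = y}, ∏ z : {z : Z // rho z = b.1}, t.1 (lam z.1)
    let _ : DecidableEq {x : X // f x = y} := Classical.decEq _
    rw [Finset.prod_univ_sum]
    refine (Finset.sum_equiv e (by simp) fun b _ => ?_).symm
    have hpb : FinGSet.IsPullback rho (p.comp lam) q f :=
      ⟨fun z => (h.1.1 z).symm, fun b x hbx => by
        obtain ⟨z, hz, hz'⟩ := h.1.2 x b hbx.symm
        exact ⟨z, ⟨hz.2, hz.1⟩, fun w hw => hz' w ⟨hw.2, hw.1⟩⟩⟩
    obtain ⟨b, rfl⟩ := b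
    refine Finset.prod_equiv (fiberEquiv hpb b) (by simp) fun z _ => ?_
    rw [he ⟨b, rfl⟩ z.1 (fiberEquiv hpb b z) z.2 rfl])

/-- The action of `G` on a ring in which every element of `G` acts as the identity. -/
abbrev trivialGRing : MulSemiringAction G R where
  smul _ r := r
  one_smul _ := rfl
  mul_smul _ _ _ := rfl
  smul_zero _ := rfl
  smul_add _ _ _ := rfl
  smul_one _ := rfl
  smul_mul _ _ _ := rfl

end FixedPoint

/-! ### The Burnside Tambara functor -/

open scoped Pointwise

/-- A finite `G`-set over `X`. -/
structure FinGSet.Over {G : Type u} [Group G] (X : FinGSet G) where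
  tot : FinGSet G
  map : tot →[G] X

namespace FinGSet.Over

attribute [local instance] Fintype.ofFinite

variable {G : Type u} [Group G] {X Y Z : FinGSet G}

/-- Isomorphism of `G`-sets over `X`. -/
def IsIso (A B : Over X) : Prop :=
  ∃ h : A.tot →[G] B.tot, Function.Bijective h ∧ ∀ a, B.map (h a) = A.map a

theorem IsIso.refl (A : Over X) : IsIso A A :=
  ⟨MulActionHom.id G, Function.bijective_id, fun _ => rfl⟩

theorem IsIso.symm {A B : Over X} : IsIso A B → IsIso B A := by
  rintro ⟨h, hb, hm⟩
  have hr : ∀ b, h (TambaraFunctor.invMap h hb b) = b := (Equiv.ofBijective h hb).right_inv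
  exact ⟨TambaraFunctor.invMap h hb, (Equiv.ofBijective h hb).symm.bijective, fun b => by
    rw [← hm, hr]⟩

theorem IsIso.trans {A B C : Over X} : IsIso A B → IsIso B C → IsIso A C := by
  rintro ⟨h, hb, hm⟩ ⟨k, kb, km⟩
  exact ⟨k.comp h, kb.comp hb, fun a => (km _).trans (hm _)⟩

instance setoid (X : FinGSet G) : Setoid (Over X) :=
  ⟨IsIso, IsIso.refl, IsIso.symm, IsIso.trans⟩

/-- The empty `G`-set over `X`. -/
def empty (X : FinGSet G) : Over X := ⟨sub X (fun _ => False) (fun _ _ h => h), subVal _ _ _⟩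

/-- The identity of `X`. -/
def one (X : FinGSet G) : Over X := ⟨X, MulActionHom.id G⟩

/-- Disjoint union over `X`. -/
def add (A B : Over X) : Over X :=
  ⟨FinGSet.sum A.tot B.tot, ⟨Sum.elim A.map B.map, by
    rintro g (a | b)
    · exact map_smul A.map g a
    · exact map_smul B.map g b⟩⟩

/-- Fibre product over `X`. -/
def mul (A B : Over X) : Over X := ⟨pb A.map B.map, A.map.comp (pbFst _ _)⟩

/-- Composition with `f : X → Y`. -/
def push (f : X →[G] Y) (A : Over X) : Over Y := ⟨A.tot, f.comp A.map⟩

/-- Pullback along `f : X → Y`. -/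
def pull (f : X →[G] Y) (B : Over Y) : Over X := ⟨pb f B.map, pbFst _ _⟩

/-- `s ⊆ A` is the image of a section of `A → X` over the fibre `f⁻¹(y)`. -/
def IsSection (f : X →[G] Y) (A : Over X) (y : Y) (s : Set A.tot) : Prop :=
  (∀ a ∈ s, f (A.map a) = y) ∧ ∀ x, f x = y → ∃! a, a ∈ s ∧ A.map a = x

theorem IsSection.smul {f : X →[G] Y} {A : Over X} {y : Y} {s : Set A.tot}
    (h : IsSection f A y s) (g : G) : IsSection f A (g • y) (g • s) := by
  constructor
  · rintro _ ⟨a, ha, rfl⟩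
    change f (A.map (g • a)) = g • y
    rw [map_smul, map_smul, h.1 a ha]
  · intro x hx
    obtain ⟨a, ⟨ha, hax⟩, hu⟩ := h.2 (g⁻¹ • x) (by rw [map_smul, hx, inv_smul_smul])
    refine ⟨g • a, ⟨Set.smul_mem_smul_set ha, by rw [map_smul, hax, smul_inv_smul]⟩, ?_⟩
    rintro _ ⟨⟨b, hb, rfl⟩, hbx⟩
    have hbx : A.map (g • b) = x := hbx
    rw [map_smul] at hbx
    have := hu b ⟨hb, by rw [← hbx, inv_smul_smul]⟩
    rw [this]

/-- The dependent product `Π_f(A) → Y` of `A → X` along `f : X → Y`: its points over `y` are the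
sections of `A → X` over the fibre `f⁻¹(y)`, encoded by their images. -/
def pi (f : X →[G] Y) (A : Over X) : Over Y :=
  letI P : FinGSet G := ⟨Y × Set A.tot⟩
  letI D : FinGSet G := sub P (fun p => IsSection f A p.1 p.2) (fun g _ h => h.smul g)
  ⟨D, ⟨fun p => p.1.1, fun _ _ => rfl⟩⟩

/-- Morphisms of `G`-sets over `X`. -/
def Hom (W A : Over X) : Type u := {h : W.tot →[G] A.tot // ∀ w, A.map (h w) = W.map w}

instance (W A : Over X) : Finite (Hom W A) :=
  Finite.of_injective (fun h : Hom W A => (h.1 : W.tot → A.tot))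
    fun _ _ h => Subtype.ext (DFunLike.coe_injective h)

theorem Hom.ext {W A : Over X} {h k : Hom W A} (e : ∀ w, h.1 w = k.1 w) : h = k :=
  Subtype.ext (MulActionHom.ext e)

/-- The number of morphisms over `X`; for transitive `W` this is a mark of `A`. -/
noncomputable def cnt (W A : Over X) : ℕ := Nat.card (Hom W A)

theorem cnt_congr_left {W W' : Over X} (h : IsIso W W') (A : Over X) : cnt W A = cnt W' A := by
  obtain ⟨e, he, hm⟩ := h
  have hr : ∀ b, e (TambaraFunctor.invMap e he b) = b := (Equiv.ofBijective e he).right_inv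
  have hl : ∀ b, TambaraFunctor.invMap e he (e b) = b := (Equiv.ofBijective e he).left_inv
  exact Nat.card_congr
    { toFun := fun h => ⟨h.1.comp (TambaraFunctor.invMap e he), fun w => by
        change A.map (h.1 (TambaraFunctor.invMap e he w)) = _
        rw [h.2, ← hm, hr]⟩
      invFun := fun h => ⟨h.1.comp e, fun w => (h.2 _).trans (hm w)⟩
      left_inv := fun h => Hom.ext fun w => congrArg h.1 (hl w)
      right_inv := fun h => Hom.ext fun w => congrArg h.1 (hr w) }

theorem cnt_congr_right (W : Over X) {A A' : Over X} (h : IsIso A A') : cnt W A = cnt W A' := by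
  obtain ⟨e, he, hm⟩ := h
  refine Nat.card_congr (Equiv.ofBijective
    (fun h => ⟨e.comp h.1, fun w => (hm _).trans (h.2 w)⟩) ⟨?_, ?_⟩)
  · intro h k hk
    exact Hom.ext fun w => he.1 (congrArg (fun h : Hom W A' => h.1 w) hk)
  · intro h
    have hr : ∀ b, e (TambaraFunctor.invMap e he b) = b := (Equiv.ofBijective e he).right_inv
    refine ⟨⟨(TambaraFunctor.invMap e he).comp h.1, fun w => ?_⟩, Hom.ext fun w => hr _⟩
    change A.map (TambaraFunctor.invMap e he (h.1 w)) = _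
    rw [← hm, hr, h.2]

theorem cnt_one (W : Over X) : cnt W (one X) = 1 := by
  have : Unique (Hom W (one X)) :=
    { default := ⟨W.map, fun _ => rfl⟩
      uniq := fun h => Hom.ext fun w => h.2 w }
  exact Nat.card_unique

theorem cnt_empty (W : Over X) (hW : W.tot.IsTransitive) : cnt W (empty X) = 0 := by
  obtain ⟨⟨w⟩, _⟩ := hW
  have : IsEmpty (Hom W (empty X)) := ⟨fun h => (h.1 w).2⟩
  exact Nat.card_of_isEmpty

theorem cnt_mul (W A B : Over X) : cnt W (mul A B) = cnt W A * cnt W B := by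
  rw [cnt, cnt, cnt, ← Nat.card_prod]
  exact Nat.card_congr
    { toFun := fun h => (⟨(pbFst _ _).comp h.1, h.2⟩,
        ⟨(pbSnd _ _).comp h.1, fun w => (h.1 w).2.symm.trans (h.2 w)⟩)
      invFun := fun h => ⟨⟨fun w => ⟨(h.1.1 w, h.2.1 w), (h.1.2 w).trans (h.2.2 w).symm⟩,
        fun g w => Subtype.ext (Prod.ext (map_smul h.1.1 g w) (map_smul h.2.1 g w))⟩, h.1.2⟩
      left_inv := fun _ => rfl
      right_inv := fun _ => rfl }

theorem cnt_add (W A B : Over X) (hW : W.tot.IsTransitive) :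
    cnt W (add A B) = cnt W A + cnt W B := by
  obtain ⟨⟨w₀⟩, hW⟩ := hW
  rw [cnt, cnt, cnt, ← Nat.card_sum]
  refine (Nat.card_congr (Equiv.ofBijective (Sum.elim
    (fun h => ⟨(FinGSet.inl _ _).comp h.1, h.2⟩)
    (fun h => ⟨(FinGSet.inr _ _).comp h.1, h.2⟩)) ⟨?_, ?_⟩)).symm
  · rintro (h | h) (k | k) hk
    · exact congrArg Sum.inl (Hom.ext fun w =>
        Sum.inl_injective (congrArg (fun h : Hom W (add A B) => h.1 w) hk))
    · exact (Sum.inl_ne_inr (congrArg (fun h : Hom W (add A B) => h.1 w₀) hk)).elim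
    · exact (Sum.inr_ne_inl (congrArg (fun h : Hom W (add A B) => h.1 w₀) hk)).elim
    · exact congrArg Sum.inr (Hom.ext fun w =>
        Sum.inr_injective (congrArg (fun h : Hom W (add A B) => h.1 w) hk))
  · intro h
    rcases h₀ : h.1 w₀ with a | b
    · have hc : ∀ w, ∃ a, h.1 w = FinGSet.inl _ _ a := fun w => by
        obtain ⟨g, rfl⟩ := hW w₀ w
        exact ⟨g • a, by rw [map_smul, h₀]; rfl⟩
      choose k hk using hc
      refine ⟨Sum.inl ⟨⟨k, fun g w => Sum.inl_injective (β := B.tot) ?_⟩, fun w => ?_⟩,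
        Hom.ext fun w => (hk w).symm⟩
      · exact (hk _).symm.trans ((map_smul h.1 g w).trans (congrArg (g • ·) (hk w)))
      · exact (congrArg (add A B).map (hk w)).symm.trans (h.2 w)
    · have hc : ∀ w, ∃ a, h.1 w = FinGSet.inr _ _ a := fun w => by
        obtain ⟨g, rfl⟩ := hW w₀ w
        exact ⟨g • b, by rw [map_smul, h₀]; rfl⟩
      choose k hk using hc
      refine ⟨Sum.inr ⟨⟨k, fun g w => Sum.inr_injective (α := A.tot) ?_⟩, fun w => ?_⟩,
        Hom.ext fun w => (hk w).symm⟩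
      · exact (hk _).symm.trans ((map_smul h.1 g w).trans (congrArg (g • ·) (hk w)))
      · exact (congrArg (add A B).map (hk w)).symm.trans (h.2 w)

theorem cnt_pull (f : X →[G] Y) (W : Over X) (B : Over Y) :
    cnt W (pull f B) = cnt (push f W) B :=
  Nat.card_congr
    { toFun := fun h => ⟨(pbSnd _ _).comp h.1, fun w =>
        (h.1 w).2.symm.trans (congrArg f (h.2 w))⟩
      invFun := fun h => ⟨⟨fun w => ⟨(W.map w, h.1 w), (h.2 w).symm⟩,
        fun g w => Subtype.ext (Prod.ext (map_smul W.map g w) (map_smul h.1 g w))⟩,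
        fun _ => rfl⟩
      left_inv := fun h => Hom.ext fun w => Subtype.ext (Prod.ext (h.2 w).symm rfl)
      right_inv := fun _ => rfl }

theorem cnt_pi (f : X →[G] Y) (W : Over Y) (A : Over X) :
    cnt W (pi f A) = cnt (pull f W) A := by
  have key : ∀ (h : Hom W (pi f A)) (v : (pull f W).tot), ∃! a, a ∈ (h.1 v.1.2).1.2 ∧
      A.map a = v.1.1 := fun h v =>
    (h.1 v.1.2).2.2 v.1.1 (v.2.trans (h.2 v.1.2).symm)
  choose φ hφ hφu using fun h v => (key h v)
  refine Nat.card_congr (Equiv.ofBijective (fun h => ⟨⟨φ h, fun g v => ?_⟩,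
    fun v => (hφ h v).2⟩) ⟨?_, ?_⟩)
  · refine (hφu h (g • v) (g • φ h v) ⟨?_, ?_⟩).symm
    · have h1 : h.1 (g • v).1.2 = g • h.1 v.1.2 := map_smul h.1 g v.1.2
      rw [h1]
      exact Set.smul_mem_smul_set (hφ h v).1
    · rw [map_smul, (hφ h v).2]
      rfl
  · intro h k hk
    have hφk : ∀ v, φ h v = φ k v := fun v =>
      congrArg (fun h : Hom (pull f W) A => h.1 v) hk
    have hs : ∀ (h k : Hom W (pi f A)), (∀ v, φ h v = φ k v) →
        ∀ w a, a ∈ (h.1 w).1.2 → a ∈ (k.1 w).1.2 := by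
      intro h k hφk w a ha
      have h1 : f (A.map a) = W.map w := ((h.1 w).2.1 a ha).trans (h.2 w)
      have h2 : a = φ k ⟨(A.map a, w), h1⟩ :=
        (hφu h ⟨(A.map a, w), h1⟩ a ⟨ha, rfl⟩).trans (hφk _)
      exact (congrArg (· ∈ (k.1 w).1.2) h2).mpr (hφ k ⟨(A.map a, w), h1⟩).1
    refine Hom.ext fun w => Subtype.ext (Prod.ext ((h.2 w).trans (k.2 w).symm) (Set.ext fun a => ?_))
    exact ⟨hs h k hφk w a, hs k h (fun v => (hφk v).symm) w a⟩
  · intro k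
    have hsec : ∀ w, IsSection f A (W.map w) {a | ∃ v : (pull f W).tot, v.1.2 = w ∧ k.1 v = a} := by
      intro w
      constructor
      · rintro _ ⟨v, rfl, rfl⟩
        exact (congrArg f (k.2 v)).trans v.2
      · intro x hx
        refine ⟨k.1 ⟨(x, w), hx⟩, ⟨⟨_, rfl, rfl⟩, k.2 _⟩, ?_⟩
        rintro _ ⟨⟨v, hv, rfl⟩, hvx⟩
        have : v = ⟨(x, w), hx⟩ := Subtype.ext (Prod.ext ((k.2 v).symm.trans hvx) hv)
        rw [this]
    let h : Hom W (pi f A) := ⟨⟨fun w => ⟨(W.map w, _), hsec w⟩, fun g w => by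
      refine Subtype.ext (Prod.ext (map_smul W.map g w) (Set.ext fun a => ?_))
      constructor
      · rintro ⟨v, hv, rfl⟩
        refine ⟨k.1 (g⁻¹ • v), ⟨g⁻¹ • v, ?_, rfl⟩, ?_⟩
        · change g⁻¹ • v.1.2 = w
          rw [hv, inv_smul_smul]
        · change g • k.1 (g⁻¹ • v) = k.1 v
          rw [← map_smul, smul_inv_smul]
      · rintro ⟨_, ⟨v, hv, rfl⟩, rfl⟩
        refine ⟨g • v, ?_, map_smul k.1 g v⟩
        change g • v.1.2 = g • w
        rw [hv]⟩, fun _ => rfl⟩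
    refine ⟨h, Hom.ext fun v => ?_⟩
    exact (hφu h v (k.1 v) ⟨⟨v, rfl, rfl⟩, k.2 v⟩).symm

/-! #### Marks separate isomorphism classes -/

/-- Congruences on `W`. -/
def Cong (W : Over X) : Type u :=
  {r : Setoid W.tot // (∀ (g : G) a b, r a b → r (g • a) (g • b)) ∧
    ∀ a b, r a b → W.map a = W.map b}

instance (W : Over X) : Finite (Cong W) :=
  Finite.of_injective (fun r : Cong W => (fun a b => r.1 a b : W.tot → W.tot → Prop))
    fun _ _ h => Subtype.ext (Setoid.ext fun a b => iff_of_eq (congrFun (congrFun h a) b))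

/-- The quotient `G`-set by a congruence. -/
def quotSet (W : Over X) (r : Cong W) : FinGSet G :=
  letI : MulAction G (Quotient r.1) :=
    { smul := fun g => Quotient.map (g • ·) (r.2.1 g)
      one_smul := by rintro ⟨a⟩; exact congrArg (Quotient.mk r.1) (one_smul G a)
      mul_smul := by rintro g h ⟨a⟩; exact congrArg (Quotient.mk r.1) (mul_smul g h a) }
  ⟨Quotient r.1⟩

/-- The quotient by a congruence, over `X`. -/
def quot (W : Over X) (r : Cong W) : Over X :=
  ⟨quotSet W r, ⟨fun w => Quotient.lift W.map r.2.2 w,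
    fun g w => by
      obtain ⟨a, rfl⟩ := Quotient.exists_rep (show Quotient r.1 from w)
      exact map_smul W.map g a⟩⟩

/-- The kernel of a morphism. -/
def ker {W A : Over X} (h : Hom W A) : Cong W :=
  ⟨Setoid.ker h.1, fun g a b hab => by
    have hab : h.1 a = h.1 b := hab
    change h.1 (g • a) = h.1 (g • b)
    rw [map_smul, map_smul, hab], fun a b hab => by
    have hab : h.1 a = h.1 b := hab
    rw [← h.2, ← h.2, hab]⟩

/-- The number of injective morphisms. -/
noncomputable def inj (W A : Over X) : ℕ := Nat.card {h : Hom W A // Function.Injective h.1}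

theorem card_ker (W A : Over X) (r : Cong W) :
    Nat.card {h : Hom W A // ker h = r} = inj (quot W r) A := by
  refine Nat.card_congr (Equiv.symm (Equiv.ofBijective (fun k =>
    ⟨⟨⟨fun w => k.1.1 (Quotient.mk r.1 w), fun g w =>
        map_smul k.1.1 g (show quotSet W r from Quotient.mk r.1 w)⟩,
      fun w => k.1.2 (Quotient.mk r.1 w)⟩, ?_⟩) ⟨?_, ?_⟩))
  · refine Subtype.ext (Setoid.ext fun a b => ?_)
    constructor
    · intro h
      exact Quotient.exact (k.2 h)
    · intro h
      exact congrArg k.1.1 (Quotient.sound h)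
  · intro k l h
    refine Subtype.ext (Hom.ext ?_)
    rintro ⟨w⟩
    exact congrArg (fun h : {h : Hom W A // ker h = r} => h.1.1 w) h
  · rintro ⟨h, rfl⟩
    refine ⟨⟨⟨⟨Quotient.lift h.1 fun _ _ h => h, ?_⟩, ?_⟩, ?_⟩, rfl⟩
    · rintro g ⟨w⟩
      exact map_smul h.1 g w
    · rintro ⟨w⟩
      exact h.2 w
    · rintro ⟨a⟩ ⟨b⟩ hab
      exact Quotient.sound hab

theorem inj_eq (A B : Over X) (hAB : ∀ W, cnt W A = cnt W B) :
    ∀ (n : ℕ) (W : Over X), Nat.card W.tot = n → inj W A = inj W B := by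
  classical
  intro n
  induction n using Nat.strong_induction_on with
  | _ n ih =>
  intro W hW
  let b : Cong W := ⟨⊥, fun g a b h => congrArg (g • ·) h, fun a b h => congrArg W.map h⟩
  have hsum : ∀ A : Over X, cnt W A = inj W A +
      ∑ r ∈ Finset.univ.erase b, inj (quot W r) A := by
    intro A
    have h1 : cnt W A = ∑ r : Cong W, Nat.card {h : Hom W A // ker h = r} := by
      rw [← Nat.card_sigma]
      exact Nat.card_congr (Equiv.sigmaFiberEquiv ker).symm
    rw [h1, ← Finset.add_sum_erase _ _ (Finset.mem_univ b)]
    congr 1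
    · refine Nat.card_congr (Equiv.subtypeEquivRight fun h => ?_)
      constructor
      · intro e x y hxy
        have : (ker h).1 x y := hxy
        rw [e] at this
        exact this
      · intro e
        refine Subtype.ext (Setoid.ext fun x y => ⟨fun h' => e h', fun h' => congrArg h.1 h'⟩)
    · exact Finset.sum_congr rfl fun r _ => card_ker W A r
  have h := hAB W
  rw [hsum A, hsum B, Finset.sum_congr rfl (g := fun r => inj (quot W r) B)] at h
  · exact Nat.add_right_cancel h
  · intro r hr
    refine ih _ ?_ _ rfl
    rw [← hW]
    have hr : r ≠ b := (Finset.mem_erase.1 hr).1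
    have hsurj : Function.Surjective (Quotient.mk r.1) := Quotient.mk_surjective
    refine lt_of_le_of_ne (Nat.card_le_card_of_surjective _ hsurj) fun hc => hr ?_
    have hinj : Function.Injective (Quotient.mk r.1) :=
      ((Nat.bijective_iff_surjective_and_card _).2 ⟨hsurj, hc.symm⟩).1
    exact Subtype.ext (Setoid.ext fun x y => ⟨fun h => hinj (Quotient.sound h), fun h => by
      have h : x = y := h
      rw [h]⟩)

theorem isIso_of_cnt (A B : Over X) (h : ∀ W, cnt W A = cnt W B) : IsIso A B := by
  have hA : ∀ A : Over X, inj A A ≠ 0 := fun A => by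
    have : Nonempty {h : Hom A A // Function.Injective h.1} :=
      ⟨⟨⟨MulActionHom.id G, fun _ => rfl⟩, fun _ _ h => h⟩⟩
    exact Nat.card_pos.ne'
  have h1 : inj A B ≠ 0 := by rw [← inj_eq A B h _ A rfl]; exact hA A
  have h2 : inj B A ≠ 0 := by rw [inj_eq A B h _ B rfl]; exact hA B
  obtain ⟨⟨k, hk⟩⟩ := (Nat.card_ne_zero.1 h1).1
  obtain ⟨⟨l, hl⟩⟩ := (Nat.card_ne_zero.1 h2).1
  have hc : Nat.card A.tot = Nat.card B.tot :=
    le_antisymm (Nat.card_le_card_of_injective _ hk) (Nat.card_le_card_of_injective _ hl)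
  exact ⟨k.1, (Nat.bijective_iff_injective_and_card _).2 ⟨hk, hc⟩, k.2⟩

/-- The set of orbits. -/
def Orb (W : Over X) : Type u := MulAction.orbitRel.Quotient G W.tot

instance (W : Over X) : Finite (Orb W) := inferInstanceAs (Finite (Quotient _))

/-- The orbit of a point. -/
def toOrb (W : Over X) (w : W.tot) : Orb W := Quotient.mk (MulAction.orbitRel G W.tot) w

theorem toOrb_smul (W : Over X) (g : G) (w : W.tot) : toOrb W (g • w) = toOrb W w :=
  Quotient.sound ⟨g, rfl⟩

/-- An orbit of `W`, as a transitive `G`-set over `X`. -/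
def orb (W : Over X) (o : Orb W) : Over X :=
  ⟨sub W.tot (fun w => toOrb W w = o) (fun g w h => (toOrb_smul W g w).trans h),
    W.map.comp (subVal _ _ _)⟩

theorem orb_transitive (W : Over X) (o : Orb W) : (orb W o).tot.IsTransitive := by
  constructor
  · obtain ⟨w, hw⟩ := Quotient.mk_surjective o
    exact ⟨⟨w, hw⟩⟩
  · rintro ⟨x, hx⟩ ⟨y, hy⟩
    obtain ⟨g, hg⟩ := Quotient.exact (hy.trans hx.symm)
    exact ⟨g, Subtype.ext hg⟩

theorem cnt_eq_prod (W A : Over X) : cnt W A = ∏ o : Orb W, cnt (orb W o) A := by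
  have hk : ∀ (k : ∀ o, Hom (orb W o) A) (o : Orb W) (w : W.tot) (h : toOrb W w = o),
      (k (toOrb W w)).1 ⟨w, rfl⟩ = (k o).1 ⟨w, h⟩ := by
    rintro k _ w rfl
    rfl
  rw [show (∏ o : Orb W, cnt (orb W o) A) = Nat.card (∀ o : Orb W, Hom (orb W o) A) from
    Nat.card_pi.symm]
  exact Nat.card_congr
    { toFun := fun h o => ⟨h.1.comp (subVal W.tot (fun w => toOrb W w = o)
        (fun g w h => (toOrb_smul W g w).trans h)), fun w => h.2 w.1⟩
      invFun := fun k => ⟨⟨fun w => (k (toOrb W w)).1 ⟨w, rfl⟩, fun g w => by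
        rw [hk k (toOrb W w) (g • w) (toOrb_smul W g w)]
        exact map_smul (k (toOrb W w)).1 g (show (orb W (toOrb W w)).tot from ⟨w, rfl⟩)⟩,
        fun w => (k (toOrb W w)).2 ⟨w, rfl⟩⟩
      left_inv := fun _ => rfl
      right_inv := fun k => funext fun o => Hom.ext fun w => hk k o w.1 w.2 }

theorem isIso_of_cnt_transitive (A B : Over X)
    (h : ∀ W : Over X, W.tot.IsTransitive → cnt W A = cnt W B) : IsIso A B :=
  isIso_of_cnt A B fun W => by
    rw [cnt_eq_prod, cnt_eq_prod]
    exact Finset.prod_congr rfl fun o _ => h _ (orb_transitive W o)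

end FinGSet.Over

/-! #### The Grothendieck ring of `G`-sets over `X` -/

namespace FinGSet

attribute [local instance] Fintype.ofFinite

variable {G : Type u} [Group G] {X Y Z : FinGSet G}

open Over

/-- Isomorphism classes of finite `G`-sets over `X`. -/
def Cls (X : FinGSet G) : Type (u + 1) := Quotient (Over.setoid X)

namespace Cls

/-- The isomorphism class of `A → X`. -/
def mk (A : Over X) : Cls X := Quotient.mk (Over.setoid X) A

theorem ind {p : Cls X → Prop} (h : ∀ A, p (mk A)) (a : Cls X) : p a := Quotient.ind h a

theorem sound {A B : Over X} (h : IsIso A B) : mk A = mk B := Quotient.sound h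

/-- The number of morphisms from `W`. -/
noncomputable def cnt (W : Over X) (a : Cls X) : ℕ :=
  Quotient.lift (Over.cnt W) (fun _ _ h => cnt_congr_right W h) a

theorem ext {a b : Cls X} (h : ∀ W : Over X, W.tot.IsTransitive → cnt W a = cnt W b) :
    a = b := by
  induction a using ind with | _ A
  induction b using ind with | _ B
  exact sound (isIso_of_cnt_transitive A B h)

instance : Zero (Cls X) := ⟨mk (Over.empty X)⟩

instance : One (Cls X) := ⟨mk (Over.one X)⟩

/-- The sum is the disjoint union. -/
instance : Add (Cls X) := ⟨Quotient.map₂ Over.add fun A A' hA B B' hB =>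
  isIso_of_cnt_transitive _ _ fun W hW => by
    rw [cnt_add _ _ _ hW, cnt_add _ _ _ hW, cnt_congr_right W hA, cnt_congr_right W hB]⟩

/-- The product is the fibre product over `X`. -/
instance : Mul (Cls X) := ⟨Quotient.map₂ Over.mul fun A A' hA B B' hB =>
  isIso_of_cnt_transitive _ _ fun W hW => by
    rw [cnt_mul, cnt_mul, cnt_congr_right W hA, cnt_congr_right W hB]⟩

theorem cnt_zero (W : Over X) (hW : W.tot.IsTransitive) : cnt W 0 = 0 := Over.cnt_empty W hW

theorem cnt_one (W : Over X) : cnt W 1 = 1 := Over.cnt_one W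

theorem cnt_add (W : Over X) (hW : W.tot.IsTransitive) (a b : Cls X) :
    cnt W (a + b) = cnt W a + cnt W b := by
  induction a using ind with | _ A
  induction b using ind with | _ B
  exact Over.cnt_add W A B hW

theorem cnt_mul (W : Over X) (a b : Cls X) : cnt W (a * b) = cnt W a * cnt W b := by
  induction a using ind with | _ A
  induction b using ind with | _ B
  exact Over.cnt_mul W A B

instance : AddCommMonoid (Cls X) where
  add_assoc a b c := ext fun W hW => by simp only [cnt_add W hW, add_assoc]
  zero_add a := ext fun W hW => by simp only [cnt_add W hW, cnt_zero W hW, zero_add]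
  add_zero a := ext fun W hW => by simp only [cnt_add W hW, cnt_zero W hW, add_zero]
  add_comm a b := ext fun W hW => by simp only [cnt_add W hW, add_comm]
  nsmul := nsmulRec

theorem mul_add (a b c : Cls X) : a * (b + c) = a * b + a * c :=
  ext fun W hW => by simp only [cnt_add W hW, cnt_mul, Nat.mul_add]

theorem add_mul (a b c : Cls X) : (a + b) * c = a * c + b * c :=
  ext fun W hW => by simp only [cnt_add W hW, cnt_mul, Nat.add_mul]

theorem mul_zero (a : Cls X) : a * 0 = 0 :=
  ext fun W hW => by simp only [cnt_zero W hW, cnt_mul, Nat.mul_zero]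

theorem zero_mul (a : Cls X) : 0 * a = 0 :=
  ext fun W hW => by simp only [cnt_zero W hW, cnt_mul, Nat.zero_mul]

/-- Marks are additive. -/
noncomputable def cntHom (W : Over X) (hW : W.tot.IsTransitive) : Cls X →+ ℤ where
  toFun a := cnt W a
  map_zero' := by rw [cnt_zero W hW]; rfl
  map_add' a b := by rw [cnt_add W hW]; push_cast; rfl

/-- Pullback of isomorphism classes along `f : X → Y`. -/
def pull (f : X →[G] Y) : Cls Y →+ Cls X where
  toFun := Quotient.map (Over.pull f) fun A B h => isIso_of_cnt _ _ fun W => by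
    rw [cnt_pull, cnt_pull, cnt_congr_right _ h]
  map_zero' := ext fun W hW => (cnt_pull f W _).trans
    ((Over.cnt_empty (push f W) hW).trans (cnt_zero W hW).symm)
  map_add' a b := by
    induction a using ind with | _ A
    induction b using ind with | _ B
    refine ext fun W hW => (cnt_pull f W _).trans ((Over.cnt_add (push f W) A B hW).trans ?_)
    exact (congrArg₂ (· + ·) (cnt_pull f W A).symm (cnt_pull f W B).symm).trans
      (cnt_add W hW (mk (Over.pull f A)) (mk (Over.pull f B))).symm

/-- Composition of isomorphism classes with `f : X → Y`. -/
def push (f : X →[G] Y) : Cls X →+ Cls Y where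
  toFun := Quotient.map (Over.push f) fun A B ⟨h, hb, hm⟩ =>
    ⟨h, hb, fun a => congrArg f (hm a)⟩
  map_zero' := sound ⟨⟨fun w => w.2.elim, fun _ w => w.2.elim⟩,
    ⟨fun w => w.2.elim, fun w => w.2.elim⟩, fun w => w.2.elim⟩
  map_add' a b := by
    induction a using ind with | _ A
    induction b using ind with | _ B
    exact sound ⟨MulActionHom.id G, Function.bijective_id, by rintro (a | b) <;> rfl⟩

/-- Dependent product of isomorphism classes along `f : X → Y`. -/
def pi (f : X →[G] Y) : Cls X → Cls Y :=
  Quotient.map (Over.pi f) fun A B h => isIso_of_cnt _ _ fun W => by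
    rw [cnt_pi, cnt_pi, cnt_congr_right _ h]

theorem cnt_pi (f : X →[G] Y) (W : Over Y) (a : Cls X) :
    cnt W (pi f a) = cnt (Over.pull f W) a := by
  induction a using ind with | _ A
  exact Over.cnt_pi f W A

end Cls

/-- `Ω(X)`: the Grothendieck group of the category of finite `G`-sets over `X`, that is, of its
isomorphism classes under disjoint union. -/
def Burnside (X : FinGSet G) : Type (u + 1) := Algebra.GrothendieckAddGroup (Cls X)

namespace Burnside

noncomputable instance : AddCommGroup (Burnside X) :=
  inferInstanceAs (AddCommGroup (Algebra.GrothendieckAddGroup (Cls X)))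

/-- The class of an effective element. -/
noncomputable def of : Cls X →+ Burnside X := Algebra.GrothendieckAddGroup.of

/-- Additive extension to the Grothendieck group. -/
noncomputable def lift {H : Type*} [AddCommGroup H] (φ : Cls X →+ H) : Burnside X →+ H :=
  Algebra.GrothendieckAddGroup.lift φ

theorem lift_of {H : Type*} [AddCommGroup H] (φ : Cls X →+ H) (a : Cls X) :
    lift φ (of a) = φ a :=
  DFunLike.congr_fun (Algebra.GrothendieckAddGroup.lift.symm_apply_apply φ) a

theorem exists_sub (x : Burnside X) : ∃ a b : Cls X, x = of a - of b := by
  induction x using AddLocalization.ind with | _ y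
  obtain ⟨a, b⟩ := y
  refine ⟨a, b, ?_⟩
  have h := Algebra.GrothendieckAddGroup.mk_sub_mk a b.1 0 0
  refine Eq.trans ?_ h.symm
  simp only [AddSubmonoid.coe_zero, add_zero, zero_add]
  rfl

theorem hom_ext {H : Type*} [AddCommGroup H] {φ ψ : Burnside X →+ H}
    (h : ∀ A : Over X, φ (of (Cls.mk A)) = ψ (of (Cls.mk A))) (x : Burnside X) : φ x = ψ x := by
  have h' : ∀ a, φ (of a) = ψ (of a) := Cls.ind h
  obtain ⟨a, b, rfl⟩ := exists_sub x
  rw [map_sub, map_sub, h', h']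

/-- The mark of a virtual `G`-set at a transitive `W → X`. -/
noncomputable def mark (W : Over X) (hW : W.tot.IsTransitive) : Burnside X →+ ℤ :=
  lift (Cls.cntHom W hW)

theorem mark_of (W : Over X) (hW : W.tot.IsTransitive) (a : Cls X) :
    mark W hW (of a) = Cls.cnt W a := lift_of _ _

theorem ext {x y : Burnside X} (h : ∀ W hW, mark W hW x = mark W hW y) : x = y := by
  obtain ⟨a, b, rfl⟩ := exists_sub x
  obtain ⟨c, d, rfl⟩ := exists_sub y
  rw [sub_eq_sub_iff_add_eq_add, ← map_add, ← map_add]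
  congr 1
  refine Cls.ext fun W hW => ?_
  have := h W hW
  simp only [map_sub, mark_of] at this
  rw [Cls.cnt_add W hW, Cls.cnt_add W hW]
  omega

/-- The multiplication of `Ω(X)`, the biadditive extension of the fibre product. -/
noncomputable def mulHom : Burnside X →+ Burnside X →+ Burnside X :=
  lift (AddMonoidHom.mk' (fun a => lift (AddMonoidHom.mk' (fun b => of (a * b)) fun b c => by
    rw [Cls.mul_add, map_add])) fun a b => AddMonoidHom.ext fun x => by
      obtain ⟨c, d, rfl⟩ := exists_sub x
      simp only [map_sub, lift_of, AddMonoidHom.add_apply, AddMonoidHom.mk'_apply, Cls.add_mul,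
        map_add])

noncomputable instance : Mul (Burnside X) := ⟨fun x y => mulHom x y⟩

noncomputable instance : One (Burnside X) := ⟨of 1⟩

theorem of_mul (a b : Cls X) : of (a * b) = of a * of b := by
  change _ = mulHom (of a) (of b)
  rw [mulHom, lift_of, AddMonoidHom.mk'_apply, lift_of, AddMonoidHom.mk'_apply]

theorem mark_one (W : Over X) (hW) : mark W hW 1 = 1 := by
  refine (mark_of W hW 1).trans ?_
  rw [Cls.cnt_one]; rfl

theorem mark_mul (W : Over X) (hW) (x y : Burnside X) :
    mark W hW (x * y) = mark W hW x * mark W hW y := by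
  obtain ⟨a, b, rfl⟩ := exists_sub x
  obtain ⟨c, d, rfl⟩ := exists_sub y
  have h : (of a - of b) * (of c - of d) =
      of (a * c) - of (a * d) - (of (b * c) - of (b * d)) := by
    have hm : ∀ x y : Burnside X, x * y = mulHom x y := fun _ _ => rfl
    simp only [of_mul, hm, map_sub, AddMonoidHom.sub_apply]
    abel
  rw [h]
  simp only [map_sub, mark_of, Cls.cnt_mul]
  push_cast
  ring

/-- `Ω(X)` is a commutative ring. -/
noncomputable instance : CommRing (Burnside X) where
  mul_assoc x y z := ext fun W hW => by simp only [mark_mul, mul_assoc]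
  one_mul x := ext fun W hW => by simp only [mark_mul, mark_one, one_mul]
  mul_one x := ext fun W hW => by simp only [mark_mul, mark_one, mul_one]
  mul_comm x y := ext fun W hW => by simp only [mark_mul, mul_comm]
  left_distrib x y z := ext fun W hW => by simp only [mark_mul, map_add, mul_add]
  right_distrib x y z := ext fun W hW => by simp only [mark_mul, map_add, add_mul]
  zero_mul x := ext fun W hW => by simp only [mark_mul, map_zero, zero_mul]
  mul_zero x := ext fun W hW => by simp only [mark_mul, map_zero, mul_zero]
  neg_add_cancel := neg_add_cancel
  sub_eq_add_neg := sub_eq_add_neg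
  zsmul := (· • ·)
  zsmul_zero' := SubNegMonoid.zsmul_zero'
  zsmul_succ' := SubNegMonoid.zsmul_succ'
  zsmul_neg' := SubNegMonoid.zsmul_neg'

/-! #### Restriction and additive transfer -/

theorem push_transitive (f : X →[G] Y) {W : Over X} (hW : W.tot.IsTransitive) :
    (Over.push f W).tot.IsTransitive := hW

theorem mark_push_pull (f : X →[G] Y) (W : Over X) (hW) (y : Burnside Y) :
    mark W hW (lift (of.comp (Cls.pull f)) y) = mark (Over.push f W) (push_transitive f hW) y := by
  refine hom_ext (φ := (mark W hW).comp (lift (of.comp (Cls.pull f)))) (fun B => ?_) y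
  rw [AddMonoidHom.comp_apply, lift_of, AddMonoidHom.comp_apply, mark_of, mark_of]
  exact congrArg Nat.cast (cnt_pull f W B)

/-- Restriction `[B → Y] ↦ [X ×_Y B → X]` along `f : X → Y`. -/
noncomputable def res (f : X →[G] Y) : Burnside Y →+* Burnside X :=
  { lift (of.comp (Cls.pull f)) with
    map_one' := ext fun W hW => by
      refine (mark_push_pull f W hW 1).trans ?_
      rw [mark_one, mark_one]
    map_mul' := fun x y => ext fun W hW => by
      refine (mark_push_pull f W hW (x * y)).trans ?_
      rw [mark_mul, mark_mul, ← mark_push_pull, ← mark_push_pull]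
      rfl }

theorem res_of (f : X →[G] Y) (B : Over Y) :
    res f (of (Cls.mk B)) = of (Cls.mk (Over.pull f B)) := lift_of _ _

theorem mark_res (f : X →[G] Y) (W : Over X) (hW) (y : Burnside Y) :
    mark W hW (res f y) = mark (Over.push f W) (push_transitive f hW) y := mark_push_pull f W hW y

/-- Additive transfer `[A → X] ↦ [A → X → Y]` along `f : X → Y`. -/
noncomputable def tr (f : X →[G] Y) : Burnside X →+ Burnside Y := lift (of.comp (Cls.push f))

theorem tr_of (f : X →[G] Y) (A : Over X) :
    tr f (of (Cls.mk A)) = of (Cls.mk (Over.push f A)) := by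
  rw [tr, lift_of]
  rfl

/-! #### Polynomial functions -/

/-- Functions on `Ω(X)` that are polynomial along all lines. -/
def IsPoly (F : Burnside X → ℤ) : Prop :=
  ∀ a b : Burnside X, ∃ P : Polynomial ℤ, ∀ t : ℤ, F (a + t • b) = P.eval t

theorem IsPoly.comp {F : Burnside Y → ℤ} (h : IsPoly F) (φ : Burnside X →+ Burnside Y) :
    IsPoly (fun x => F (φ x)) := fun a b => by
  obtain ⟨P, hP⟩ := h (φ a) (φ b)
  exact ⟨P, fun t => by
    change F (φ (a + t • b)) = _
    rw [map_add, map_zsmul, hP]⟩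

theorem IsPoly.prod {ι : Type*} [Fintype ι] {F : ι → Burnside X → ℤ} (h : ∀ i, IsPoly (F i)) :
    IsPoly (fun x => ∏ i, F i x) := fun a b => by
  choose P hP using fun i => h i a b
  exact ⟨∏ i, P i, fun t => by simp only [hP, Polynomial.eval_prod]⟩

/-- Polynomial functions that agree on effective elements agree. -/
theorem IsPoly.ext {F F' : Burnside X → ℤ} (h : IsPoly F) (h' : IsPoly F')
    (e : ∀ A : Over X, F (of (Cls.mk A)) = F' (of (Cls.mk A))) (x : Burnside X) : F x = F' x := by
  have e' : ∀ a, F (of a) = F' (of a) := Cls.ind e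
  obtain ⟨a, b, rfl⟩ := exists_sub x
  obtain ⟨P, hP⟩ := h (of a) (of b)
  obtain ⟨P', hP'⟩ := h' (of a) (of b)
  have hPP : P = P' := by
    refine Polynomial.eq_of_infinite_eval_eq P P'
      (Set.infinite_of_injective_forall_mem (f := fun n : ℕ => (n : ℤ)) Nat.cast_injective
        fun n => ?_)
    change P.eval (n : ℤ) = P'.eval (n : ℤ)
    rw [← hP, ← hP', natCast_zsmul, ← map_nsmul, ← map_add, e']
  have h1 := hP (-1)
  have h2 := hP' (-1)
  rw [neg_one_zsmul, ← sub_eq_add_neg] at h1 h2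
  rw [h1, h2, hPP]

/-- The multiplicative extension of marks to not necessarily transitive `W → X`. -/
noncomputable def mmark (W : Over X) (x : Burnside X) : ℤ :=
  ∏ o : Orb W, mark (orb W o) (orb_transitive W o) x

theorem mmark_of (W : Over X) (A : Over X) : mmark W (of (Cls.mk A)) = Over.cnt W A := by
  rw [mmark, cnt_eq_prod]
  push_cast
  exact Finset.prod_congr rfl fun o _ => mark_of _ _ _

theorem exists_poly_mark (W : Over X) (hW) (a b : Burnside X) :
    ∃ P : Polynomial ℤ, P.natDegree ≤ 1 ∧ ∀ t : ℤ, mark W hW (a + t • b) = P.eval t :=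
  ⟨Polynomial.C (mark W hW b) * Polynomial.X + Polynomial.C (mark W hW a),
    Polynomial.natDegree_linear_le, fun t => by
      simp only [map_add, map_zsmul, smul_eq_mul, Polynomial.eval_add, Polynomial.eval_mul,
        Polynomial.eval_C, Polynomial.eval_X]
      ring⟩

theorem exists_poly_mmark (W : Over X) (a b : Burnside X) : ∃ P : Polynomial ℤ,
    P.natDegree ≤ Nat.card (Orb W) ∧ ∀ t : ℤ, mmark W (a + t • b) = P.eval t := by
  choose P hd hP using fun o : Orb W => exists_poly_mark (orb W o) (orb_transitive W o) a b
  refine ⟨∏ o, P o, ?_, fun t => by simp only [mmark, hP, Polynomial.eval_prod]⟩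
  refine (Polynomial.natDegree_prod_le _ _).trans ((Finset.sum_le_sum fun o _ => hd o).trans ?_)
  rw [Finset.sum_const, smul_eq_mul, mul_one, Finset.card_univ, Nat.card_eq_fintype_card]

theorem isPoly_mark (W : Over X) (hW) : IsPoly (mark W hW) := fun a b =>
  let ⟨P, _, hP⟩ := exists_poly_mark W hW a b
  ⟨P, hP⟩

theorem isPoly_mmark (W : Over X) : IsPoly (mmark W) := fun a b =>
  let ⟨P, _, hP⟩ := exists_poly_mmark W a b
  ⟨P, hP⟩

/-! #### Multiplicative transfer -/

theorem card_orb_pull_le (f : X →[G] Y) (W : Over Y) (hW : W.tot.IsTransitive) :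
    Nat.card (Orb (Over.pull f W)) ≤ Nat.card X := by
  obtain ⟨⟨w₀⟩, hW⟩ := hW
  have h : Function.Surjective (fun x : {x : X // f x = W.map w₀} =>
      toOrb (Over.pull f W) (⟨(x.1, w₀), x.2⟩ : pb f W.map)) := by
    intro o
    obtain ⟨⟨⟨x, w⟩, hxw⟩, rfl⟩ := Quotient.mk_surjective o
    obtain ⟨g, rfl⟩ := hW w w₀
    have hx : f (g • x) = W.map (g • w) := by
      rw [map_smul, map_smul]; exact congrArg (g • ·) hxw
    exact ⟨⟨g • x, hx⟩, Quotient.sound ⟨g, rfl⟩⟩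
  exact (Nat.card_le_card_of_surjective _ h).trans
    (Nat.card_le_card_of_injective _ Subtype.val_injective)

theorem exists_extrapolation (N : ℕ) : ∃ c : ℕ → ℤ, ∀ P : Polynomial ℤ, P.natDegree ≤ N →
    P.eval (-1) = ∑ k ∈ Finset.range (N + 1), c k * P.eval (k : ℤ) := by
  refine ⟨fun k => -(-1) ^ (N + 1) * ((-1) ^ (N + 1 - (k + 1)) * ((N + 1).choose (k + 1) : ℤ)),
    fun P hP => ?_⟩
  have h := congrFun (Polynomial.fwdDiff_iter_eq_zero_of_degree_lt (Nat.lt_succ_of_le hP)) (-1)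
  rw [fwdDiff_iter_eq_sum_shift, Finset.sum_range_succ'] at h
  simp only [smul_eq_mul, Nat.succ_eq_add_one, Nat.sub_zero, Nat.choose_zero_right, Nat.cast_one,
    mul_one, zero_smul, add_zero, Pi.zero_apply, Nat.cast_add, neg_add_cancel_comm_assoc,
    nsmul_eq_mul] at h
  have h2 : ((-1 : ℤ) ^ (N + 1)) * (-1) ^ (N + 1) = 1 := by
    rw [← mul_pow]; simp
  simp only [mul_assoc, ← Finset.mul_sum] at h ⊢
  linear_combination (-1 : ℤ) ^ (N + 1) * h - P.eval (-1) * h2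

theorem exists_nm (f : X →[G] Y) (x : Burnside X) :
    ∃ y : Burnside Y, ∀ W hW, mark W hW y = mmark (Over.pull f W) x := by
  obtain ⟨a, b, rfl⟩ := exists_sub x
  obtain ⟨c, hc⟩ := exists_extrapolation (Nat.card X)
  refine ⟨∑ k ∈ Finset.range (Nat.card X + 1), c k • of (Cls.pi f (a + k • b)), fun W hW => ?_⟩
  obtain ⟨P, hd, hP⟩ := exists_poly_mmark (Over.pull f W) (of a) (of b)
  have h1 := hP (-1)
  rw [neg_one_zsmul, ← sub_eq_add_neg] at h1
  rw [h1, hc P (hd.trans (card_orb_pull_le f W hW)), map_sum]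
  refine Finset.sum_congr rfl fun k _ => ?_
  rw [map_zsmul, smul_eq_mul, mark_of, Cls.cnt_pi, ← hP, natCast_zsmul, ← map_nsmul, ← map_add]
  congr 1
  generalize a + k • b = d
  induction d using Cls.ind with | _ A
  exact (mmark_of _ A).symm

/-- Multiplicative transfer along `f : X → Y`: the map with `[A → X] ↦ [Π_f(A) → Y]` on effective
elements, extended to virtual elements polynomially, that is, by the formula
`mark_W (f_• x) = mark_{X ×_Y W} (x)` for the marks. -/
noncomputable def nm (f : X →[G] Y) : Burnside X →* Burnside Y where
  toFun x := (exists_nm f x).choose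
  map_one' := ext fun W hW => by
    rw [(exists_nm f 1).choose_spec, mark_one]
    exact Finset.prod_eq_one fun o _ => mark_one _ _
  map_mul' x y := ext fun W hW => by
    rw [(exists_nm f (x * y)).choose_spec, mark_mul, (exists_nm f x).choose_spec,
      (exists_nm f y).choose_spec, mmark, mmark, mmark, ← Finset.prod_mul_distrib]
    exact Finset.prod_congr rfl fun o _ => mark_mul _ _ _ _

theorem mark_nm (f : X →[G] Y) (W : Over Y) (hW) (x : Burnside X) :
    mark W hW (nm f x) = mmark (Over.pull f W) x := (exists_nm f x).choose_spec W hW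

theorem nm_of (f : X →[G] Y) (A : Over X) :
    nm f (of (Cls.mk A)) = of (Cls.mk (Over.pi f A)) := ext fun W hW => by
  rw [mark_nm, mark_of, mmark_of]
  exact congrArg Nat.cast (Over.cnt_pi f W A).symm

theorem isPoly_mark_nm (f : X →[G] Y) (W : Over Y) (hW) :
    IsPoly (fun x => mark W hW (nm f x)) := by
  simp only [mark_nm]
  exact isPoly_mmark _

/-- Maps into `Ω(Y)` whose marks are polynomial agree if they agree on effective elements. -/
theorem ext_poly {F F' : Burnside X → Burnside Y} (h : ∀ W hW, IsPoly (fun x => mark W hW (F x)))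
    (h' : ∀ W hW, IsPoly (fun x => mark W hW (F' x)))
    (e : ∀ A : Over X, F (of (Cls.mk A)) = F' (of (Cls.mk A))) (x : Burnside X) : F x = F' x :=
  ext fun W hW => (h W hW).ext (h' W hW) (fun A => congrArg _ (e A)) x

end Burnside

end FinGSet

namespace FinGSet.Burnside

attribute [local instance] Fintype.ofFinite

variable {G : Type u} [Group G] {X Y : FinGSet G}

open Over

theorem cnt_eq {W W' : Over X} (h : IsIso W W') (A : Over X) :
    (Over.cnt W A : ℤ) = Over.cnt W' A := congrArg Nat.cast (cnt_congr_left h A)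

theorem of_sound {A B : Over X} (h : IsIso A B) : of (Cls.mk A) = of (Cls.mk B) :=
  congrArg of (Cls.sound h)

theorem res_id (t : Burnside X) : res (MulActionHom.id G : X →[G] X) t = t :=
  ext fun W hW => mark_res _ W hW t

theorem tr_id (t : Burnside X) : tr (MulActionHom.id G : X →[G] X) t = t := by
  refine hom_ext (φ := tr (MulActionHom.id G)) (ψ := AddMonoidHom.id _) (fun A => ?_) t
  rw [tr_of]
  rfl

theorem tr_comp {Z : FinGSet G} (g : Y →[G] Z) (f : X →[G] Y) (t : Burnside X) :
    tr (g.comp f) t = tr g (tr f t) := by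
  refine hom_ext (φ := tr (g.comp f)) (ψ := (tr g).comp (tr f)) (fun A => ?_) t
  rw [AddMonoidHom.comp_apply, tr_of, tr_of, tr_of]
  rfl

/-- Marks of multiplicative transfers at arbitrary `W → Y`. -/
theorem mmark_nm {f : X →[G] Y} (W : Over Y) (x : Burnside X) :
    mmark W (nm f x) = mmark (Over.pull f W) x := by
  refine IsPoly.ext (F := fun x => mmark W (nm f x)) ?_ (isPoly_mmark _) (fun A => ?_) x
  · exact IsPoly.prod fun o => isPoly_mark_nm f _ _
  · simp only [nm_of, mmark_of, Over.cnt_pi]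

theorem mackey_tr {X' Y' : FinGSet G} (ξ : X' →[G] X) (f' : X' →[G] Y') (f : X →[G] Y)
    (η : Y' →[G] Y) (h : FinGSet.IsPullback ξ f' f η) (t : Burnside Y') :
    res f (tr η t) = tr ξ (res f' t) := by
  refine hom_ext (φ := (res f).toAddMonoidHom.comp (tr η))
    (ψ := (tr ξ).comp (res f').toAddMonoidHom) (fun A => ?_) t
  change res f (tr η _) = tr ξ (res f' _)
  rw [tr_of, res_of, res_of, tr_of]
  refine Eq.symm (of_sound (A := Over.push ξ (Over.pull f' A))
    (B := Over.pull f (Over.push η A))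
    ⟨⟨fun p => ⟨(ξ p.1.1, p.1.2), ?_⟩, ?_⟩, ⟨?_, ?_⟩, ?_⟩)
  · exact (h.1 p.1.1).trans (congrArg η p.2)
  · intro g p
    exact Subtype.ext (Prod.ext (map_smul ξ g p.1.1) rfl)
  · intro p q hpq
    have h1 : ξ p.1.1 = ξ q.1.1 := congrArg (fun r => r.1.1) hpq
    have h2 : p.1.2 = q.1.2 := congrArg (fun r => r.1.2) hpq
    obtain ⟨c, _, hc⟩ := h.2 (ξ p.1.1) (f' p.1.1) (h.1 _)
    refine Subtype.ext (Prod.ext ((hc _ ⟨rfl, rfl⟩).trans (hc _ ⟨h1.symm, ?_⟩).symm) h2)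
    exact q.2.trans ((congrArg A.map h2.symm).trans p.2.symm)
  · intro p
    obtain ⟨c, hc, _⟩ := h.2 p.1.1 (A.map p.1.2) p.2
    exact ⟨⟨(c, p.1.2), hc.2⟩, Subtype.ext (Prod.ext hc.1 rfl)⟩
  · intro p
    rfl

theorem mackey_nm {X' Y' : FinGSet G} (ξ : X' →[G] X) (f' : X' →[G] Y') (f : X →[G] Y)
    (η : Y' →[G] Y) (h : FinGSet.IsPullback ξ f' f η) (t : Burnside Y') :
    res f (nm η t) = nm ξ (res f' t) := by
  refine ext_poly (F := fun t => res f (nm η t)) (F' := fun t => nm ξ (res f' t))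
    (fun W hW => ?_) (fun W hW => ?_) (fun A => ?_) t
  · simp only [mark_res]
    exact isPoly_mark_nm _ _ _
  · exact (isPoly_mark_nm ξ W hW).comp (res f').toAddMonoidHom
  · simp only [nm_of, res_of]
    refine of_sound (isIso_of_cnt _ _ fun W => ?_)
    rw [cnt_pull, Over.cnt_pi, Over.cnt_pi, cnt_pull]
    refine Eq.symm (cnt_congr_left (W := Over.push f' (Over.pull ξ W))
      (W' := Over.pull η (Over.push f W))
      ⟨⟨fun p => ⟨(f' p.1.1, p.1.2), ?_⟩, ?_⟩, ⟨?_, ?_⟩, ?_⟩ A)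
    · exact (h.1 p.1.1).symm.trans (congrArg f p.2)
    · intro g p
      exact Subtype.ext (Prod.ext (map_smul f' g p.1.1) rfl)
    · intro p q hpq
      have h1 : f' p.1.1 = f' q.1.1 := congrArg (fun r => r.1.1) hpq
      have h2 : p.1.2 = q.1.2 := congrArg (fun r => r.1.2) hpq
      obtain ⟨c, _, hc⟩ := h.2 (ξ p.1.1) (f' p.1.1) (h.1 _)
      refine Subtype.ext (Prod.ext ((hc _ ⟨rfl, rfl⟩).trans (hc _ ⟨?_, h1.symm⟩).symm) h2)
      exact q.2.trans ((congrArg W.map h2.symm).trans p.2.symm)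
    · intro p
      obtain ⟨c, hc, _⟩ := h.2 (W.map p.1.2) p.1.1 p.2.symm
      exact ⟨⟨(c, p.1.2), hc.1⟩, Subtype.ext (Prod.ext hc.2 rfl)⟩
    · intro p
      rfl

theorem cnt_push (q : X →[G] Y) (W : Over Y) (C : Over X) :
    Over.cnt W (Over.push q C) = ∑ l : Hom W ⟨X, q⟩, Over.cnt ⟨W.tot, l.1⟩ C := by
  rw [show (∑ l : Hom W ⟨X, q⟩, Over.cnt ⟨W.tot, l.1⟩ C) =
    Nat.card (Σ l : Hom W ⟨X, q⟩, Hom ⟨W.tot, l.1⟩ C) from Nat.card_sigma.symm]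
  exact Nat.card_congr
    { toFun := fun h => ⟨⟨C.map.comp h.1, h.2⟩, ⟨h.1, fun _ => rfl⟩⟩
      invFun := fun p => ⟨p.2.1, fun w => (congrArg q (p.2.2 w)).trans (p.1.2 w)⟩
      left_inv := fun _ => rfl
      right_inv := by
        rintro ⟨⟨l, hl⟩, ⟨h, hh⟩⟩
        change W.tot →[G] C.tot at h
        obtain rfl : C.map.comp h = l := MulActionHom.ext hh
        rfl }

theorem mark_tr (q : X →[G] Y) (W : Over Y) (hW : W.tot.IsTransitive) (x : Burnside X) :
    mark W hW (tr q x) = ∑ l : Hom W ⟨X, q⟩, mark ⟨W.tot, l.1⟩ hW x := by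
  refine (hom_ext (φ := (mark W hW).comp (tr q))
    (ψ := ∑ l : Hom W ⟨X, q⟩, mark ⟨W.tot, l.1⟩ hW) (fun A => ?_) x).trans
    (AddMonoidHom.finsetSum_apply _ _ _)
  rw [AddMonoidHom.comp_apply, tr_of, mark_of, AddMonoidHom.finsetSum_apply]
  refine (congrArg Nat.cast (cnt_push q W A)).trans ?_
  rw [Nat.cast_sum]
  exact Finset.sum_congr rfl fun l _ => (mark_of ⟨W.tot, l.1⟩ hW (Cls.mk A)).symm

theorem isPoly_mark_tr {Z : FinGSet G} (q : X →[G] Y) (W : Over Y) (hW : W.tot.IsTransitive)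
    {F : Burnside Z → Burnside X} (hF : ∀ W hW, IsPoly (fun x => mark W hW (F x))) :
    IsPoly (fun x => mark W hW (tr q (F x))) := fun a b => by
  choose P hP using fun l : Hom W ⟨X, q⟩ => hF ⟨W.tot, l.1⟩ hW a b
  refine ⟨∑ l, P l, fun t => ?_⟩
  change mark W hW (tr q (F (a + t • b))) = _
  rw [mark_tr, Polynomial.eval_finsetSum]
  exact Finset.sum_congr rfl fun l _ => hP l t

theorem distrib {A₀ Z B : FinGSet G} (f : X →[G] Y) (p : A₀ →[G] X) (lam : Z →[G] A₀)
    (rho : Z →[G] B) (q : B →[G] Y) (h : FinGSet.IsExponential f p lam rho q) (t : Burnside A₀) :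
    nm f (tr p t) = tr q (nm rho (res lam t)) := by
  refine ext_poly (F := fun t => nm f (tr p t)) (F' := fun t => tr q (nm rho (res lam t)))
    (fun W hW => ?_) (fun W hW => ?_) (fun A => ?_) t
  · exact (isPoly_mark_nm f W hW).comp (tr p)
  · exact (isPoly_mark_tr q W hW (fun W hW => isPoly_mark_nm rho W hW)).comp
      (res lam).toAddMonoidHom
  · simp only [nm_of, res_of, tr_of]
    let C : Over B := Over.pi rho (Over.pull lam A)
    let s (c : C.tot) : Set A.tot := {a | ∃ v ∈ c.1.2, v.1.2 = a}
    have hs : ∀ c : C.tot, IsSection f (Over.push p A) (q (C.map c)) (s c) := by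
      intro c
      constructor
      · rintro _ ⟨v, hv, rfl⟩
        have h1 : rho v.1.1 = C.map c := c.2.1 v hv
        have h2 : lam v.1.1 = A.map v.1.2 := v.2
        change f (p (A.map v.1.2)) = _
        rw [← h2, ← h1]
        exact h.1.1 v.1.1
      · intro x hx
        obtain ⟨z, ⟨hz1, hz2⟩, hzu⟩ := h.1.2 x (C.map c) hx
        obtain ⟨v, ⟨hv, hvz⟩, hvu⟩ := c.2.2 z hz2
        have hvz : v.1.1 = z := hvz
        refine ⟨v.1.2, ⟨⟨v, hv, rfl⟩, ?_⟩, ?_⟩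
        · change p (A.map v.1.2) = x
          rw [← hz1, ← hvz]
          exact congrArg p v.2.symm
        · rintro _ ⟨⟨v', hv', rfl⟩, hx'⟩
          have hx' : p (A.map v'.1.2) = x := hx'
          have h2 : lam v'.1.1 = A.map v'.1.2 := v'.2
          have h3 : v'.1.1 = z := hzu _ ⟨(congrArg p h2).trans hx', c.2.1 v' hv'⟩
          exact congrArg (fun v => v.1.2) (hvu v' ⟨hv', h3⟩)
    refine Eq.symm (of_sound (A := Over.push q C) (B := Over.pi f (Over.push p A))
      ⟨⟨fun c => ⟨(q (C.map c), s c), hs c⟩, ?_⟩, ⟨?_, ?_⟩, ?_⟩)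
    · intro g c
      refine Subtype.ext (Prod.ext ?_ (Set.ext fun a => ?_))
      · change q (C.map (g • c)) = g • q (C.map c)
        exact (congrArg q (map_smul C.map g c)).trans (map_smul q g _)
      · constructor
        · rintro ⟨_, ⟨v, hv, rfl⟩, rfl⟩
          exact ⟨v.1.2, ⟨v, hv, rfl⟩, rfl⟩
        · rintro ⟨_, ⟨v, hv, rfl⟩, rfl⟩
          exact ⟨g • v, ⟨v, hv, rfl⟩, rfl⟩
    · intro c d hcd
      have hq : q (C.map c) = q (C.map d) := congrArg (fun r => r.1.1) hcd
      have hsd : s c = s d := congrArg (fun r => r.1.2) hcd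
      choose σ hσ hσu using fun x : {x : X // f x = q (C.map c)} => (hs c).2 x.1 x.2
      have hb : ∀ d : C.tot, q (C.map d) = q (C.map c) → s d = s c →
          ∀ (z : Z) (x : {x : X // f x = q (C.map c)}), rho z = C.map d → p (lam z) = x.1 →
            lam z = A.map (σ x) := by
        intro d _ hsd z x hz hx
        obtain ⟨v, ⟨hv, hvz⟩, _⟩ := d.2.2 z hz
        have hvz : v.1.1 = z := hvz
        have hvl : lam v.1.1 = A.map v.1.2 := v.2
        rw [← hvz, hvl]
        refine congrArg A.map (hσu x v.1.2 ⟨?_, ?_⟩)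
        · rw [← hsd]
          exact ⟨v, hv, rfl⟩
        · change p (A.map v.1.2) = x.1
          rw [← hvl, hvz, hx]
      obtain ⟨b, _, hbu⟩ := h.2 (q (C.map c)) (fun x => A.map (σ x)) (fun x => (hσ x).2)
      have hcd' : C.map c = C.map d :=
        (hbu _ ⟨rfl, hb c rfl rfl⟩).trans (hbu _ ⟨hq.symm, hb d hq.symm hsd.symm⟩).symm
      have hsub : ∀ c d : C.tot, C.map c = C.map d → s c = s d → ∀ v ∈ c.1.2, v ∈ d.1.2 := by
        intro c d hcd' hsd v hv
        have hv' : v.1.2 ∈ s d := by rw [← hsd]; exact ⟨v, hv, rfl⟩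
        obtain ⟨v', hv', he⟩ := hv'
        have h1 : lam v.1.1 = A.map v.1.2 := v.2
        have h2 : lam v'.1.1 = A.map v'.1.2 := v'.2
        have h3 : rho v.1.1 = C.map c := c.2.1 v hv
        have h4 : rho v'.1.1 = C.map d := d.2.1 v' hv'
        have h5 : lam v'.1.1 = lam v.1.1 := by rw [h1, h2, he]
        obtain ⟨z, _, hz⟩ := h.1.2 (p (lam v.1.1)) (C.map c) (by rw [← h3]; exact h.1.1 _)
        have h6 : v = v' := Subtype.ext (Prod.ext ((hz _ ⟨rfl, h3⟩).trans
          (hz _ ⟨congrArg p h5, h4.trans hcd'.symm⟩).symm) he.symm)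
        rw [h6]
        exact hv'
      exact Subtype.ext (Prod.ext hcd' (Set.ext fun v =>
        ⟨hsub c d hcd' hsd v, hsub d c hcd'.symm hsd.symm v⟩))
    · rintro ⟨⟨y, r⟩, hr⟩
      choose σ hσ hσu using fun x : {x : X // f x = y} => hr.2 x.1 x.2
      obtain ⟨b, ⟨hby, hbz⟩, _⟩ := h.2 y (fun x => A.map (σ x)) (fun x => (hσ x).2)
      have hc : IsSection rho (Over.pull lam A) b {v | rho v.1.1 = b ∧ v.1.2 ∈ r} := by
        constructor
        · intro v hv
          exact hv.1
        · intro z hz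
          have hfz : f (p (lam z)) = y := by
            rw [← hby, ← hz]
            exact h.1.1 z
          have hl := hbz z ⟨p (lam z), hfz⟩ hz rfl
          refine ⟨⟨(z, σ ⟨p (lam z), hfz⟩), hl⟩, ⟨⟨hz, (hσ _).1⟩, rfl⟩, ?_⟩
          rintro v ⟨⟨_, hv2⟩, hvz⟩
          have hvz : v.1.1 = z := hvz
          refine Subtype.ext (Prod.ext hvz (hσu ⟨p (lam z), hfz⟩ _ ⟨hv2, ?_⟩))
          have h2 : lam v.1.1 = A.map v.1.2 := v.2
          change p (A.map v.1.2) = p (lam z)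
          rw [← h2, hvz]
      refine ⟨⟨(b, _), hc⟩, Subtype.ext (Prod.ext hby (Set.ext fun a => ?_))⟩
      constructor
      · rintro ⟨v, hv, rfl⟩
        exact hv.2
      · intro ha
        have hay : f (p (A.map a)) = y := hr.1 a ha
        obtain ⟨z, ⟨hz1, hz2⟩, _⟩ := h.1.2 (p (A.map a)) b (hay.trans hby.symm)
        refine ⟨⟨(z, a), ?_⟩, ⟨hz2, ha⟩, rfl⟩
        have hl := hbz z ⟨p (A.map a), hay⟩ hz2 hz1
        exact hl.trans (congrArg A.map (hσu ⟨p (A.map a), hay⟩ a ⟨ha, rfl⟩).symm)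
    · intro c
      rfl

theorem additive (X Y : FinGSet G) : Function.Bijective
    (fun t : Burnside (FinGSet.sum X Y) => (res (inl X Y) t, res (inr X Y) t)) := by
  have hd : ∀ t : Burnside (FinGSet.sum X Y),
      t = tr (inl X Y) (res (inl X Y) t) + tr (inr X Y) (res (inr X Y) t) := by
    intro t
    refine hom_ext (φ := AddMonoidHom.id _)
      (ψ := (tr (inl X Y)).comp (res (inl X Y)).toAddMonoidHom +
        (tr (inr X Y)).comp (res (inr X Y)).toAddMonoidHom) (fun A => ?_) t
    change _ = tr (inl X Y) (res (inl X Y) _) + tr (inr X Y) (res (inr X Y) _)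
    rw [res_of, res_of, tr_of, tr_of, ← map_add]
    refine (of_sound (A := Over.add (Over.push (inl X Y) (Over.pull (inl X Y) A))
      (Over.push (inr X Y) (Over.pull (inr X Y) A))) ⟨⟨Sum.elim (fun p => p.1.2)
      (fun p => p.1.2), ?_⟩, ⟨?_, ?_⟩, ?_⟩).symm
    · rintro g (p | p) <;> rfl
    · rintro (p | p) (p' | p') hpp
      · have hpp : p.1.2 = p'.1.2 := hpp
        exact congrArg Sum.inl (Subtype.ext (Prod.ext (Sum.inl_injective
          (p.2.trans ((congrArg A.map hpp).trans p'.2.symm))) hpp))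
      · have hpp : p.1.2 = p'.1.2 := hpp
        exact (Sum.inl_ne_inr (p.2.trans ((congrArg A.map hpp).trans p'.2.symm))).elim
      · have hpp : p.1.2 = p'.1.2 := hpp
        exact (Sum.inr_ne_inl (p.2.trans ((congrArg A.map hpp).trans p'.2.symm))).elim
      · have hpp : p.1.2 = p'.1.2 := hpp
        exact congrArg Sum.inr (Subtype.ext (Prod.ext (Sum.inr_injective
          (p.2.trans ((congrArg A.map hpp).trans p'.2.symm))) hpp))
    · intro a
      rcases ha : A.map a with x | y
      · exact ⟨Sum.inl ⟨(x, a), ha.symm⟩, rfl⟩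
      · exact ⟨Sum.inr ⟨(y, a), ha.symm⟩, rfl⟩
    · rintro (p | p)
      · exact p.2.symm
      · exact p.2.symm
  have hsub : ∀ Z : FinGSet G, IsEmpty Z → ∀ s t : Burnside Z, s = t := fun Z hZ s t =>
    ext fun W hW => (hZ.false (W.map hW.1.some)).elim
  have hid : ∀ (Z : FinGSet G) (t : Burnside Z),
      tr (MulActionHom.id G) (res (MulActionHom.id G : Z →[G] Z) t) = t := fun Z t => by
    rw [res_id, tr_id]
  have hself : ∀ (Z : FinGSet G) (i : Z →[G] FinGSet.sum X Y), Function.Injective i →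
      ∀ t, res i (tr i t) = t := fun Z i hi t => by
    have h : FinGSet.IsPullback (MulActionHom.id G : Z →[G] Z) (MulActionHom.id G) i i :=
      ⟨fun _ => rfl, fun x y hxy => ⟨x, ⟨rfl, hi hxy⟩, fun z hz => hz.1⟩⟩
    rw [mackey_tr _ _ _ _ h, hid]
  have hdis : ∀ (Z Z' : FinGSet G) (i : Z →[G] FinGSet.sum X Y) (j : Z' →[G] FinGSet.sum X Y),
      (∀ z z', i z ≠ j z') → ∀ t, res i (tr j t) = 0 := fun Z Z' i j h t => by
    have hp : FinGSet.IsPullback (pbFst i j) (pbSnd i j) i j :=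
      ⟨fun p => p.2, fun x z hxz => (h x z hxz).elim⟩
    rw [mackey_tr _ _ _ _ hp, hsub (pb i j) ⟨fun p => h _ _ p.2⟩ (res (pbSnd i j) t) 0, map_zero]
  have hl := hself _ (inl X Y) Sum.inl_injective
  have hr := hself _ (inr X Y) Sum.inr_injective
  have hlr := hdis _ _ (inl X Y) (inr X Y) (fun x z h => Sum.inl_ne_inr h)
  have hrl := hdis _ _ (inr X Y) (inl X Y) (fun x z h => Sum.inr_ne_inl h)
  constructor
  · intro s t h
    rw [hd s, hd t, show res (inl X Y) s = res (inl X Y) t from congrArg Prod.fst h,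
      show res (inr X Y) s = res (inr X Y) t from congrArg Prod.snd h]
  · rintro ⟨s, t⟩
    refine ⟨tr (inl X Y) s + tr (inr X Y) t, ?_⟩
    simp only [map_add, hl, hr, hlr, hrl, add_zero, zero_add]

/-- The Burnside Tambara functor `Ω`: `Ω(X) = K₀` of finite `G`-sets over `X`. -/
noncomputable def _root_.burnsideTambara (G : Type u) [Group G] : TambaraFunctor.{u, u + 1} G where
  obj X := Burnside X
  res f := res f
  tr f := tr f
  nm f := nm f
  res_id _ := res_id
  tr_id _ := tr_id
  nm_id X t := by
    refine ext_poly (F := fun t => nm (MulActionHom.id G) t) (F' := fun t => t)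
      (fun W hW => isPoly_mark_nm _ W hW) isPoly_mark (fun A => ?_) t
    simp only [nm_of]
    refine of_sound (isIso_of_cnt _ _ fun W => ?_)
    rw [Over.cnt_pi]
    refine cnt_congr_left (W := Over.pull (MulActionHom.id G) W) (W' := W)
      ⟨pbSnd _ _, ⟨?_, ?_⟩, fun p => p.2.symm⟩ A
    · intro p q hpq
      have hpq : p.1.2 = q.1.2 := hpq
      exact Subtype.ext (Prod.ext (p.2.trans ((congrArg W.map hpq).trans q.2.symm)) hpq)
    · intro w
      exact ⟨⟨(W.map w, w), rfl⟩, rfl⟩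
  res_comp g f t := ext fun W hW => by
    rw [mark_res, mark_res, mark_res]
    rfl
  tr_comp := tr_comp
  nm_comp g f t := ext fun W hW => by
    rw [mark_nm, mark_nm, mmark_nm]
    refine IsPoly.ext (isPoly_mmark _) (isPoly_mmark _) (fun A => ?_) t
    rw [mmark_of, mmark_of]
    refine cnt_eq (W := Over.pull (g.comp f) W) (W' := Over.pull f (Over.pull g W))
      ⟨⟨fun p => ⟨(p.1.1, ⟨(f p.1.1, p.1.2), p.2⟩), rfl⟩, ?_⟩, ⟨?_, ?_⟩, ?_⟩ A
    · intro a p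
      exact Subtype.ext (Prod.ext rfl (Subtype.ext (Prod.ext (map_smul f a p.1.1) rfl)))
    · intro p q hpq
      exact Subtype.ext (Prod.ext (congrArg (fun r => r.1.1) hpq)
        (congrArg (fun r => r.1.2.1.2) hpq))
    · rintro ⟨⟨x, ⟨⟨y, w⟩, hyw⟩⟩, hx⟩
      have hx : f x = y := hx
      subst hx
      exact ⟨⟨(x, w), hyw⟩, rfl⟩
    · intro p
      rfl
  additive := additive
  mackey_tr := mackey_tr
  mackey_nm := mackey_nm
  distrib := distrib

end FinGSet.Burnside

/-! For a point `x` of `X`, counting the points over `x` extends to a ring homomorphism `degree x`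
from `Ω(X)` to `ℤ`; it is the mark at the orbit map from `G/e` to `X` through `x`. Collected over
all `x`, these maps form a morphism of Tambara functors from `Ω` to `𝒫_ℚ` (`degreeHom`): a pullback
has the same fibres, the fibre of a composite is a disjoint union of fibres, and the fibre of a
dependent product is a set of sections, hence a product of fibres.

Over `G/e` every transitive `W` is free, so the degree at `1` embeds `Ω(G/e)` in `ℤ` and the non
zero divisors are exactly the elements of nonzero degree (`mem_nonZeroDivisors_free`). Therefore
`S₀` consists of the virtual `G`-sets of nonzero cardinality, and an element of `𝒰_𝒵(X)` has nonzero
degree at every point. Its image in `𝒫_ℚ(X)` is a nowhere vanishing rational function, hence a unit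
(`isUnit_degreeHom`), and the universal property of fractions extends `degreeHom` to `𝒰_𝒵⁻¹Ω`
(`fracLift`).

The extension is bijective for two reasons, both resting on `G/e`. For injectivity, an element `t`
all of whose degrees vanish has zero marks at free orbits, while the pullback of `G/e` has zero
marks at all other orbits. So their product is zero (`res_free_mul_eq_zero`), and `G/e` is an
admissible denominator because its cardinality is not zero. For surjectivity, an invariant rational
function becomes integral after multiplication by some `b`, and an invariant integral function
becomes a degree function after multiplication by `|G|`: it is realized by a combination of the maps
from `G/e` to `X` (`exists_degree_eq`). The denominator is the integer `b * |G|`, pulled back from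
the point. -/

namespace TambaraFunctor

variable {G : Type u} [Group G]

/-- A morphism of Tambara functors whose components are bijective is an isomorphism. -/
noncomputable def Iso.ofBijective {T : TambaraFunctor.{u, v} G} {T' : TambaraFunctor.{u, w} G}
    (φ : Hom T T') (h : ∀ X, Function.Bijective (φ.app X)) : Iso T T' where
  hom := φ
  inv :=
    { app := fun X => (RingEquiv.ofBijective (φ.app X) (h X)).symm
      -- Since the components of `φ` are injective, each identity for the inverses may be checked
      -- after applying `φ`, where it becomes the compatibility of `φ` itself.
      app_res := fun {X Y} f t => (h X).1 <| by
        rw [φ.app_res]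
        exact ((RingEquiv.ofBijective _ (h X)).apply_symm_apply _).trans
          (congrArg _ ((RingEquiv.ofBijective _ (h Y)).apply_symm_apply _).symm)
      app_tr := fun {X Y} f t => (h Y).1 <| by
        rw [φ.app_tr]
        exact ((RingEquiv.ofBijective _ (h Y)).apply_symm_apply _).trans
          (congrArg _ ((RingEquiv.ofBijective _ (h X)).apply_symm_apply _).symm)
      app_nm := fun {X Y} f t => (h Y).1 <| by
        rw [φ.app_nm]
        exact ((RingEquiv.ofBijective _ (h Y)).apply_symm_apply _).trans
          (congrArg _ ((RingEquiv.ofBijective _ (h X)).apply_symm_apply _).symm) }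
  hom_inv X := (RingEquiv.ofBijective (φ.app X) (h X)).symm_apply_apply
  inv_hom X := (RingEquiv.ofBijective (φ.app X) (h X)).apply_symm_apply

/-! ### Universal property of fractions of Tambara functors -/

namespace MulSubfunctor

variable {T : TambaraFunctor.{u, v} G} {T' : TambaraFunctor.{u, w} G} (S : MulSubfunctor T)
  (φ : Hom T T') (hφ : ∀ (X : FinGSet G), ∀ s ∈ S.carrier X, IsUnit (φ.app X s))

/-- The component at `X` of the extension of `φ` to fractions. -/
noncomputable def fracLiftApp (X : FinGSet G) : Localization (S.carrier X) →+* T'.obj X :=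
  IsLocalization.lift (M := S.carrier X) (g := φ.app X) fun s => hφ X s s.2

/-- The defining property with the denominator cleared. As `φ.app X s` is a unit, it determines the
value on a fraction, so the compatibilities below can be proved without writing inverses. -/
theorem fracLiftApp_mk_mul (X : FinGSet G) (x : T.obj X) (s : S.carrier X) :
    S.fracLiftApp φ hφ X (Localization.mk x s) * φ.app X s = φ.app X x := by
  have h := IsLocalization.mk'_spec (Localization (S.carrier X)) x s
  rw [← Localization.mk_eq_mk'] at h
  have he := fun t => IsLocalization.lift_eq (S := Localization (S.carrier X)) (g := φ.app X)
    (fun s : S.carrier X => hφ X s s.2) t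
  rw [← he, ← he, ← h]
  exact (map_mul (S.fracLiftApp φ hφ X) _ _).symm

theorem fracLiftApp_res {X Y : FinGSet G} (f : X →[G] Y) (z : Localization (S.carrier Y)) :
    S.fracLiftApp φ hφ X (S.fracRes f z) = T'.res f (S.fracLiftApp φ hφ Y z) := by
  induction z using Localization.induction_on with | _ z
  obtain ⟨x, s⟩ := z
  rw [fracRes_mk]
  refine (hφ X _ (S.res_mem f s.2)).mul_right_cancel ?_
  refine (S.fracLiftApp_mk_mul φ hφ X (T.res f x) ⟨_, S.res_mem f s.2⟩).trans ?_
  rw [φ.app_res, φ.app_res, ← map_mul, fracLiftApp_mk_mul]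

/-- Additive transfers are not multiplicative, so the denominator must first be made a restriction
`f^* r`. The projection formula in `T'` then moves the image of `r` inside the transfer, where it
cancels the denominator of the fraction. -/
theorem fracLiftApp_tr {X Y : FinGSet G} (f : X →[G] Y) (z : Localization (S.carrier X)) :
    S.fracLiftApp φ hφ Y (S.fracTr f z) = T'.tr f (S.fracLiftApp φ hφ X z) := by
  induction z using Localization.induction_on with | _ z
  obtain ⟨x, s⟩ := z
  obtain ⟨a, r, ha⟩ := S.exists_denominator f s
  rw [S.fracTr_mk f ha]
  refine (hφ Y r r.2).mul_right_cancel ?_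
  -- Both sides become transfers of the product of the images of `a`, of `s` and of the fraction
  -- `x/s`, because `a * s = f^* r`.
  rw [fracLiftApp_mk_mul, φ.app_tr, ← T'.tr_mul_res, ← φ.app_res, ← ha, map_mul (φ.app X),
    map_mul (φ.app X), ← S.fracLiftApp_mk_mul φ hφ X x s]
  congr 1
  ring

theorem fracLiftApp_nm {X Y : FinGSet G} (f : X →[G] Y) (z : Localization (S.carrier X)) :
    S.fracLiftApp φ hφ Y (S.fracNm f z) = T'.nm f (S.fracLiftApp φ hφ X z) := by
  induction z using Localization.induction_on with | _ z
  obtain ⟨x, s⟩ := z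
  rw [fracNm_mk]
  refine (hφ Y _ (S.nm_mem f s.2)).mul_right_cancel ?_
  refine (S.fracLiftApp_mk_mul φ hφ Y (T.nm f x) ⟨_, S.nm_mem f s.2⟩).trans ?_
  rw [φ.app_nm, φ.app_nm, ← map_mul, fracLiftApp_mk_mul]

/-- A morphism that sends `S` to units extends to the fractions. -/
noncomputable def fracLift : Hom S.frac T' where
  app := S.fracLiftApp φ hφ
  app_res := S.fracLiftApp_res φ hφ
  app_tr := S.fracLiftApp_tr φ hφ
  app_nm := S.fracLiftApp_nm φ hφ

/-- The extension of `φ` to fractions is bijective if `S` kills the kernel of `φ` and every element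
of the target is a fraction. -/
theorem fracLift_bijective (X : FinGSet G)
    (hinj : ∀ x, φ.app X x = 0 → ∃ s ∈ S.carrier X, s * x = 0)
    (hsurj : ∀ y, ∃ x, ∃ s ∈ S.carrier X, y * φ.app X s = φ.app X x) :
    Function.Bijective ((S.fracLift φ hφ).app X) := by
  change Function.Bijective (S.fracLiftApp φ hφ X)
  constructor
  · refine (injective_iff_map_eq_zero _).2 fun z hz => ?_
    induction z using Localization.induction_on with | _ z
    obtain ⟨x, s⟩ := z
    have h := S.fracLiftApp_mk_mul φ hφ X x s
    rw [hz, zero_mul] at h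
    obtain ⟨c, hc, hcx⟩ := hinj x h.symm
    -- The numerator lies in the kernel of `φ`, so an admissible denominator `c` annihilates it;
    -- this is equality of the fraction with `0/1`.
    rw [← Localization.mk_zero 1, Localization.mk_eq_mk_iff, Localization.r_iff_exists]
    exact ⟨⟨c, hc⟩, by simpa using hcx⟩
  · intro y
    obtain ⟨x, s, hs, h⟩ := hsurj y
    exact ⟨Localization.mk x ⟨s, hs⟩, (hφ X s hs).mul_right_cancel
      ((S.fracLiftApp_mk_mul φ hφ X x ⟨s, hs⟩).trans h.symm)⟩

end MulSubfunctor

end TambaraFunctor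

/-! ### Free orbits over `X` and the maps out of them -/

namespace FinGSet

attribute [local instance] Fintype.ofFinite

variable {G : Type u} [Group G] {X Y : FinGSet G}

theorem Burnside.mark_congr {W W' : Over X} (h : Over.IsIso W W') (hW : W.tot.IsTransitive)
    (hW' : W'.tot.IsTransitive) (t : Burnside X) : mark W hW t = mark W' hW' t :=
  hom_ext (φ := mark W hW) (ψ := mark W' hW') (fun A => by
    rw [mark_of, mark_of]
    exact cnt_eq h A) t

variable [Finite G]

theorem free_isTransitive : (free G).IsTransitive :=
  ⟨⟨(1 : G)⟩, fun x y => ⟨(y * x⁻¹ : G), inv_mul_cancel_right (y : G) x⟩⟩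

namespace Over

/-- The `G`-map `G/e → X`, `g ↦ g • x`, as a `G`-set over `X`. -/
def ofPoint (x : X) : Over X := ⟨free G, ⟨fun g : G => g • x, fun g h : G => mul_smul g h x⟩⟩

theorem ofPoint_isTransitive (x : X) : (ofPoint x).tot.IsTransitive := free_isTransitive

/-- Maps from `G/e` over `X` are points of the fibre. -/
def homOfPointEquiv (x : X) (A : Over X) : Hom (ofPoint x) A ≃ {a : A.tot // A.map a = x} where
  toFun h := ⟨h.1 (1 : G), (h.2 (1 : G)).trans (one_smul G x)⟩
  invFun a := ⟨⟨fun g : G => g • a.1, fun g h : G => mul_smul g h a.1⟩, fun g : G =>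
    (map_smul A.map g a.1).trans (congrArg (g • ·) a.2)⟩
  left_inv h := Hom.ext fun g : G =>
    (map_smul h.1 g (1 : G)).symm.trans (congrArg h.1 (mul_one g))
  right_inv a := Subtype.ext (one_smul G a.1)

/-- The coordinate in `G` of a point of the pullback of `G/e → Y`. -/
def pullCoord (f : X →[G] Y) (y : Y) (p : (pull f (ofPoint y)).tot) : G := p.1.2

/-- A point of the pullback is a pair `(x, g)` with `f x = g • y`. Translating by `g⁻¹` brings it to
second coordinate `1`, with first coordinate in the fibre over `y`: the pullback is a free `G`-set
with basis that fibre. -/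
theorem map_inv_pullCoord_smul (f : X →[G] Y) (y : Y) (p : (pull f (ofPoint y)).tot) :
    f ((pullCoord f y p)⁻¹ • p.1.1) = y := by
  have h : f p.1.1 = pullCoord f y p • y := p.2
  rw [map_smul, h, inv_smul_smul]

/-- Maps from the pullback of `G/e → Y` are families of points over the fibre of `f`. -/
noncomputable def homPullOfPointEquiv (f : X →[G] Y) (y : Y) (A : Over X) :
    Hom (pull f (ofPoint y)) A ≃ (∀ x : {x : X // f x = y}, {a : A.tot // A.map a = x.1}) where
  -- The pairs `(x, 1)` are the basis of the free `G`-set; an equivariant map is determined by its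
  -- values there, which can be chosen freely.
  toFun h x := ⟨h.1 ⟨(x.1, (1 : G)), x.2.trans (one_smul G y).symm⟩, h.2 _⟩
  invFun σ := ⟨⟨fun p => pullCoord f y p • (σ ⟨_, map_inv_pullCoord_smul f y p⟩).1, fun g p => by
      -- Points in one orbit have the same basis point, so only the translating factor changes under
      -- the action; this gives equivariance.
      have e : (pullCoord f y (g • p))⁻¹ • (g • p).1.1 = (pullCoord f y p)⁻¹ • p.1.1 := by
        change (g * pullCoord f y p)⁻¹ • g • p.1.1 = _
        rw [mul_inv_rev, mul_smul, inv_smul_smul]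
      exact (congrArg (fun x => (g * pullCoord f y p) • (σ x).1) (Subtype.ext e)).trans
        (mul_smul g (pullCoord f y p) _)⟩, fun p => by
    change A.map (pullCoord f y p • _) = p.1.1
    rw [map_smul, (σ _).2, smul_inv_smul]⟩
  left_inv h := Hom.ext fun p => by
    refine (map_smul h.1 (pullCoord f y p) _).symm.trans
      (congrArg h.1 (Subtype.ext (Prod.ext ?_ ?_)))
    · exact smul_inv_smul (pullCoord f y p) p.1.1
    · exact mul_one (pullCoord f y p)
  right_inv σ := funext fun x => Subtype.ext <| by
    have e : (1 : G)⁻¹ • x.1 = x.1 := by rw [inv_one, one_smul]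
    exact (one_smul G _).trans (congrArg (fun x => (σ x).1) (Subtype.ext e))

/-- A transitive `G`-set over `X` that maps to `G/e` is given by a point of `X`. -/
theorem isIso_ofPoint {W : Over X} (hW : W.tot.IsTransitive) (h : W.tot →[G] free G) (w : W.tot) :
    IsIso (ofPoint (W.map w)) W := by
  refine ⟨⟨fun g : G => g • w, fun g k : G => mul_smul g k w⟩, ⟨?_, fun w' => hW.2 w w'⟩,
    fun g : G => map_smul W.map g w⟩
  -- The stabilizer of `w` is trivial because it fixes `h w` in `G`, where left translation is free.
  -- Surjectivity of the orbit map is transitivity of `W`.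
  have key : ∀ g k : G, g • w = k • w → g = k := fun g k hgk =>
    mul_right_cancel (G := G) (b := h w)
      ((map_smul h g w).symm.trans ((congrArg h hgk).trans (map_smul h k w)))
  exact fun g k => key g k

end Over

/-! ### Degrees: marks at free orbits -/

namespace Burnside

open Over

/-- The cardinality of the fibre over a point. -/
noncomputable def degree (x : X) : Burnside X →+* ℤ :=
  { mark (ofPoint x) (ofPoint_isTransitive x) with
    map_one' := mark_one _ _
    map_mul' := mark_mul _ _ }

theorem degree_apply (x : X) (t : Burnside X) :
    degree x t = mark (ofPoint x) (ofPoint_isTransitive x) t := rfl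

/-- A mark counts maps over `X`, and a map out of `G/e` is the choice of the image of `1`. -/
theorem degree_of (x : X) (A : Over X) :
    degree x (of (Cls.mk A)) = Nat.card {a : A.tot // A.map a = x} := by
  rw [degree_apply, mark_of]
  exact congrArg Nat.cast (Nat.card_congr (homOfPointEquiv x A))

/-- A transitive `G`-set that maps to `G/e` is a copy of `G/e`. So the degrees know every mark at
such a `W`, and the marks they miss are those at non-free orbits. -/
theorem mark_eq_degree {W : Over X} (hW : W.tot.IsTransitive) (h : W.tot →[G] free G) (w : W.tot)
    (t : Burnside X) : mark W hW t = degree (W.map w) t :=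
  (mark_congr (isIso_ofPoint hW h w) _ hW t).symm

/-- Translation by `g` identifies the fibres over `x` and `g • x`. This makes the degrees an
invariant function, as membership in `𝒫_ℚ(X)` requires. -/
theorem degree_smul (g : G) (x : X) (t : Burnside X) : degree (g • x) t = degree x t :=
  hom_ext (φ := (degree (g • x)).toAddMonoidHom) (ψ := (degree x).toAddMonoidHom) (fun A => by
    change degree (g • x) _ = degree x _
    rw [degree_of, degree_of]
    exact congrArg Nat.cast (Nat.card_congr (fiberSMul A.map g x).symm)) t

/-- Marks of a restriction are marks at the composite with `f`, and the orbit map through `x`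
composed with `f` is the orbit map through `f x`. -/
theorem degree_res (f : X →[G] Y) (x : X) (t : Burnside Y) :
    degree x (res f t) = degree (f x) t := by
  rw [degree_apply, mark_res, degree_apply]
  have h : IsIso (Over.push f (ofPoint x)) (ofPoint (f x)) :=
    ⟨MulActionHom.id G, Function.bijective_id, fun g : G => (map_smul f g x).symm⟩
  exact mark_congr h _ _ t

/-- For a `G`-set `A` over `X`, the fibre over `y` of the composite to `Y` is the disjoint union of
the fibres over the points of `f⁻¹(y)`; additivity extends this to virtual elements. -/
theorem degree_tr (f : X →[G] Y) (y : Y) (t : Burnside X) :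
    degree y (tr f t) = ∑ x : {x : X // f x = y}, degree x.1 t := by
  refine (hom_ext (φ := (degree y).toAddMonoidHom.comp (tr f))
    (ψ := ∑ x : {x : X // f x = y}, (degree x.1).toAddMonoidHom) (fun A => ?_) t).trans
    (AddMonoidHom.finsetSum_apply _ _ _)
  rw [AddMonoidHom.finsetSum_apply]
  change degree y (tr f _) = ∑ x : {x : X // f x = y}, degree x.1 _
  simp only [tr_of, degree_of]
  rw [← Nat.cast_sum, ← Nat.card_sigma]
  exact congrArg Nat.cast (Nat.card_congr (fiberComp f A.map y).symm)

/-- On effective elements the left side counts maps out of the pullback of `G/e`, which is free on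
`f⁻¹(y)`, hence families of points in the fibres. Neither side is additive, so virtual elements are
reached by polynomiality along lines. -/
theorem degree_nm (f : X →[G] Y) (y : Y) (t : Burnside X) :
    degree y (nm f t) = ∏ x : {x : X // f x = y}, degree x.1 t := by
  refine IsPoly.ext (F := fun t => degree y (nm f t))
    (F' := fun t => ∏ x : {x : X // f x = y}, degree x.1 t) (isPoly_mark_nm f _ _)
    (IsPoly.prod fun x => isPoly_mark _ _) (fun A => ?_) t
  simp only [degree_of]
  rw [degree_apply, mark_nm, mmark_of, ← Nat.cast_prod, ← Nat.card_pi]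
  exact congrArg Nat.cast (Nat.card_congr (homPullOfPointEquiv f y A))

theorem degree_of_ofPoint (x y : X) :
    degree y (of (Cls.mk (ofPoint x))) = Nat.card {g : G // g • x = y} := degree_of y (ofPoint x)

/-- `G/e` in `Ω(G/G)` kills all elements of degree zero. -/
theorem res_free_mul_eq_zero {t : Burnside X} (h : ∀ x : X, degree x t = 0) :
    res (toPoint X) (of (Cls.mk (ofPoint PUnit.unit))) * t = 0 := by
  refine ext fun W hW => ?_
  rw [mark_mul, map_zero, mark_res, mark_of]
  change (Over.cnt _ (ofPoint _) : ℤ) * _ = 0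
  -- At every transitive `W` one factor has mark zero: the pulled back `G/e` if `W` has no map to
  -- `G/e`, and `t` if it has one, since its mark at `W` is then a degree.
  rcases isEmpty_or_nonempty (Hom (Over.push (toPoint X) W) (ofPoint PUnit.unit)) with hE | ⟨⟨k⟩⟩
  · rw [Over.cnt, Nat.card_of_isEmpty, Nat.cast_zero, zero_mul]
  · obtain ⟨w⟩ := hW.1
    rw [mark_eq_degree hW k.1 w, h, mul_zero]

/-- The structure map of any `W` over `G/e` is itself a map to `G/e`, so all marks are degrees; all
points of `G/e` are translates of `1`, so they are all one and the same degree. Thus `Ω(G/e)` embeds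
in `ℤ`. -/
theorem eq_of_degree_free {s t : Burnside (free G)}
    (h : degree (X := free G) (1 : G) s = degree (X := free G) (1 : G) t) : s = t := by
  have h' : ∀ (g : G) (r : Burnside (free G)),
      degree (X := free G) g r = degree (X := free G) (1 : G) r := fun g r => by
    rw [← degree_smul g (1 : G) r]
    exact congrArg (fun x => degree (X := free G) x r) (mul_one g).symm
  refine ext fun W hW => ?_
  obtain ⟨w⟩ := hW.1
  rw [mark_eq_degree hW W.map w s, mark_eq_degree hW W.map w t]
  exact (h' _ s).trans (h.trans (h' _ t).symm)

/-- The degree at `1` is an injective ring homomorphism to a domain, so only zero can be a zero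
divisor. This makes the condition defining `S₀` numerical. -/
theorem mem_nonZeroDivisors_free {t : Burnside (free G)} :
    t ∈ nonZeroDivisors (Burnside (free G)) ↔ degree (X := free G) (1 : G) t ≠ 0 := by
  rw [mem_nonZeroDivisors_iff_right]
  constructor
  · intro h h0
    have ht : t = 0 := eq_of_degree_free (h0.trans (map_zero _).symm)
    -- If zero were not a zero divisor, `1 * 0 = 0` would force `1 = 0` in `Ω(G/e)`, which the
    -- degree excludes.
    have h1 := congrArg (degree (X := free G) (1 : G)) (h 1 (by rw [ht, mul_zero]))
    rw [map_one, map_zero] at h1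
    exact one_ne_zero h1
  · intro h s hs
    refine eq_of_degree_free ?_
    rw [map_zero]
    refine (mul_eq_zero.1 ?_).resolve_right h
    rw [← map_mul, hs, map_zero]

end Burnside

end FinGSet

/-! ### The degree morphism to `𝒫_ℚ` and its behaviour on `𝒰_𝒵` -/

namespace FinGSet.Burnside

attribute [local instance] Fintype.ofFinite trivialGRing

open TambaraFunctor Over

variable {G : Type u} [Group G] [Finite G] {X Y : FinGSet G}

/-- The morphism `Ω → 𝒫_ℚ` given by the cardinalities of the fibres. -/
noncomputable def degreeHom (G : Type u) [Group G] [Finite G] :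
    TambaraFunctor.Hom (burnsideTambara G) (fixedPointFunctor G ℚ) where
  app _ :=
    -- The action on `ℚ` is trivial by definition, so equivariance is plain invariance.
    { toFun := fun t => ⟨fun x => (degree x t : ℚ), fun g x =>
        congrArg (Int.cast : ℤ → ℚ) (degree_smul g x t)⟩
      map_one' := Subtype.ext (funext fun x =>
        (congrArg (Int.cast : ℤ → ℚ) (map_one (degree x))).trans Int.cast_one)
      map_mul' := fun s t => Subtype.ext (funext fun x =>
        (congrArg (Int.cast : ℤ → ℚ) (map_mul (degree x) s t)).trans (Int.cast_mul _ _))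
      map_zero' := Subtype.ext (funext fun x =>
        (congrArg (Int.cast : ℤ → ℚ) (map_zero (degree x))).trans Int.cast_zero)
      map_add' := fun s t => Subtype.ext (funext fun x =>
        (congrArg (Int.cast : ℤ → ℚ) (map_add (degree x) s t)).trans (Int.cast_add _ _)) }
  app_res f t := Subtype.ext (funext fun x => congrArg (Int.cast : ℤ → ℚ) (degree_res f x t))
  app_tr f t := Subtype.ext (funext fun y =>
    (congrArg (Int.cast : ℤ → ℚ) (degree_tr f y t)).trans (Int.cast_sum _ _))
  app_nm f t := Subtype.ext (funext fun y =>
    (congrArg (Int.cast : ℤ → ℚ) (degree_nm f y t)).trans (Int.cast_prod _ _))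

/-- The semi-Mackey subfunctor `𝒰_𝒵` of `Ω^μ`. -/
noncomputable abbrev maxRegular (G : Type u) [Group G] [Finite G] :
    MulSubfunctor (burnsideTambara G) :=
  maxSub (nonZeroDivisors ((burnsideTambara G).obj (free G)))

/-- Restricted along the orbit map of `x`, the element `t` divides in `Ω(G/e)` the pullback of some
`r` in `S₀`. That pullback has nonzero degree, and a factor of an element of nonzero degree has
nonzero degree. -/
theorem degree_ne_zero_of_mem {t : Burnside X} (ht : t ∈ (maxRegular G).carrier X) (x : X) :
    degree x t ≠ 0 := by
  let f : free G →[G] X := (ofPoint x).map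
  have hx := ht (free G) f free_isTransitive
  obtain ⟨a, r, hr, h⟩ := mem_maxSubmonoid.1 hx
  have hr : degree (X := free G) (1 : G) (res (toPoint (free G)) r) ≠ 0 :=
    mem_nonZeroDivisors_free.1 hr
  have h : res f t * (show Burnside (free G) from a) = res (toPoint (free G)) r := h
  intro h0
  refine hr ?_
  have h1 : degree (X := free G) (1 : G) (res f t) = degree x t :=
    (degree_res f (1 : G) t).trans
      (congrArg (fun z : X => degree z t) (one_smul G x))
  rw [← h, map_mul, h1, h0, zero_mul]

/-- The source of all denominators used below: `r` belongs to `S₀`, and its pullback to `X`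
restricts on each transitive `Z` to its pullback to `Z`, so the cofactor `1` suffices. -/
theorem res_toPoint_mem {r : Burnside (point G)} (hr : degree (X := point G) PUnit.unit r ≠ 0)
    (X : FinGSet G) : res (toPoint X) r ∈ (maxRegular G).carrier X := by
  intro Z h _
  refine mem_maxSubmonoid.2 ⟨1, r, ?_, ?_⟩
  · refine mem_nonZeroDivisors_free.2 ?_
    exact fun h => hr ((degree_res (toPoint (free G)) (1 : G) r).symm.trans h)
  · rw [mul_one]
    exact ((burnsideTambara G).res_comp (toPoint X) h r).symm

theorem exists_mul_eq_zero {t : Burnside X} (ht : (degreeHom G).app X t = 0) :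
    ∃ s ∈ (maxRegular G).carrier X, s * (show (burnsideTambara G).obj X from t) = 0 := by
  -- The annihilator is the pullback of `G/e`. Its degree over the point is the number of elements
  -- of `G`, and only its being positive matters.
  refine ⟨res (toPoint X) (of (Cls.mk (ofPoint PUnit.unit))), res_toPoint_mem ?_ X,
    res_free_mul_eq_zero fun x => ?_⟩
  · rw [degree_of_ofPoint]
    have : Nonempty {g : G // g • (PUnit.unit : point G) = PUnit.unit} := ⟨⟨1, rfl⟩⟩
    exact Nat.cast_ne_zero.2 Nat.card_pos.ne'
  · exact Int.cast_injective ((congrFun (congrArg Subtype.val ht) x).trans Int.cast_zero.symm)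

/-- Integral invariant functions are degrees up to a factor `|G|`. -/
theorem exists_degree_eq (c : X → ℤ) (hc : ∀ (g : G) x, c (g • x) = c x) :
    ∃ t : Burnside X, ∀ x, degree x t = c x * Nat.card G := by
  classical
  -- One copy of `G/e` is attached to every point, not to every orbit, so that the factor is `|G|`
  -- everywhere instead of the order of a stabilizer.
  refine ⟨∑ x, c x • of (Cls.mk (ofPoint x)), fun y => ?_⟩
  have h : ∀ x, (Nat.card {g : G // g • x = y} : ℤ) = ∑ g : G, if x = g⁻¹ • y then 1 else 0 := by
    intro x
    rw [Nat.card_eq_fintype_card, Fintype.card_subtype, Finset.sum_boole]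
    simp only [eq_inv_smul_iff]
  simp only [map_sum, map_zsmul, degree_of_ofPoint, h, smul_eq_mul, Finset.mul_sum]
  -- With the sum over `G` outside, each `g` selects the single point `x = g⁻¹ • y`, of weight `c
  -- (g⁻¹ • y) = c y`, and the total is `c y` times `|G|`.
  rw [Finset.sum_comm]
  simp [hc, mul_comm, Nat.card_eq_fintype_card]

/-- Two denominators are needed: `b` makes the values of `ψ` integral, and `|G|` turns the resulting
integral function into a degree function. -/
theorem exists_mul_degreeHom_eq (ψ : (fixedPointFunctor G ℚ).obj X) :
    ∃ t, ∃ s ∈ (maxRegular G).carrier X, ψ * (degreeHom G).app X s = (degreeHom G).app X t := by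
  have hψ : ∀ (g : G) x, ψ.1 (g • x) = ψ.1 x := ψ.2
  obtain ⟨b, hb⟩ := IsLocalization.exist_integer_multiples_of_finite (nonZeroDivisors ℤ) ψ.1
  choose c hc using hb
  have hc : ∀ x, (c x : ℚ) = (b : ℤ) * ψ.1 x := fun x => (hc x).trans (zsmul_eq_mul _ _)
  -- Because `b` is the same at all points, the integral function `c = b ψ` inherits the invariance
  -- of `ψ`.
  obtain ⟨t, ht⟩ := exists_degree_eq c fun g x => by
    have h : (c (g • x) : ℚ) = c x := by rw [hc, hc, hψ]
    exact_mod_cast h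
  have hn : ((b : ℤ) * Nat.card G : ℤ) ≠ 0 :=
    mul_ne_zero (nonZeroDivisors.coe_ne_zero b) (Nat.cast_ne_zero.2 Nat.card_pos.ne')
  -- The denominator is an integer of the ring `Ω(G/G)`. A ring homomorphism to `ℤ` fixes integers,
  -- so all its degrees equal `b * |G|`.
  refine ⟨t, res (toPoint X) (((b : ℤ) * Nat.card G : ℤ) : Burnside (point G)),
    res_toPoint_mem ?_ X, Subtype.ext (funext fun x => ?_)⟩
  · rwa [map_intCast]
  · change ψ.1 x * (degree x (res (toPoint X) _) : ℚ) = (degree x t : ℚ)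
    rw [ht, map_intCast, map_intCast]
    push_cast
    rw [hc]
    ring

/-- A function to a field without zeros has a pointwise inverse, and the inverse of an invariant
function is invariant. -/
theorem isUnit_degreeHom (X : FinGSet G) (s : Burnside X)
    (hs : s ∈ (maxRegular G).carrier X) :
    IsUnit ((degreeHom G).app X s) := by
  have h : ∀ x : X, (degree x s : ℚ) ≠ 0 := fun x => Int.cast_ne_zero.2 (degree_ne_zero_of_mem hs x)
  refine IsUnit.of_mul_eq_one ⟨fun x => (degree x s : ℚ)⁻¹, fun g x => ?_⟩
    (Subtype.ext (funext fun x => mul_inv_cancel₀ (h x)))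
  exact congrArg (fun n : ℤ => (n : ℚ)⁻¹) (degree_smul g x s)

end FinGSet.Burnside

open FinGSet.Burnside in
theorem mainTheorem9 {G : Type u} [Group G] [Finite G] :
    Nonempty (TambaraFunctor.Iso
      (TambaraFunctor.MulSubfunctor.frac
        (TambaraFunctor.maxSub (T := burnsideTambara G)
          (nonZeroDivisors ((burnsideTambara G).obj (FinGSet.free G)))))
      (@fixedPointFunctor G _ ℚ _ (trivialGRing G ℚ))) := by
  exact ⟨.ofBijective ((maxRegular G).fracLift (degreeHom G) isUnit_degreeHom) fun X =>
    (maxRegular G).fracLift_bijective _ _ X (fun _ => exists_mul_eq_zero) exists_mul_degreeHom_eq⟩
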